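/- **Setting.** Let $E=\langle e_1,\dots,e_5\rangle$ be complex, $F=E^\vee$ with dual basis $f_1,\dots,f_5$, and let $V_{10}=E\oplus F$ carry its natural symmetric form $(\cdot,\cdot)$ for which $E,F$ are isotropic. Let $V_{10}$ act on $\Lambda E=\Delta_+\oplus\Delta_-$ by Clifford multiplication (exterior product by $E$, contraction by $F$), let $\langle \eta,\delta\rangle$ be the coefficient of $e_1\wedge\dots\wedge e_5$ in $\eta^{\mathrm{rev}}\wedge\delta$, where $\mathrm{rev}$ is the reversal anti-automorphism, and let $\gamma:S^2\Delta_+\to V_{10}$ be defined by $(\gamma(\delta\eta),v)=\langle\eta,v\cdot\delta\rangle$. Write $e_{ij\cdots}=e_i\wedge e_j\wedge\cdots$ and let $\mathfrak c=\langle p_1,p_2,p_3,p_4\rangle\subset\mathbb C^4\otimes\Delta_+$ be the Cartan subspace with basis $$\begin{aligned}p_1&=a_1\otimes e_{53}+a_2\otimes e_{1245}+a_3\otimes e_{42}+a_4\otimes e_{31},& p_2&=a_1\otimes e_{52}+a_2\otimes e_{1345}+a_3\otimes e_{34}+a_4\otimes e_{12},\\ p_3&=a_1\otimes e_{1234}+a_2\otimes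 1+a_3\otimes e_{1235}+a_4\otimes e_{54},& p_4&=a_1\otimes e_{14}+a_2\otimes e_{23}+a_3\otimes e_{51}+a_4\otimes e_{2345},\end{aligned}$$ where $a_1,\dots,a_4$ is the standard basis of $\mathbb C^4$. A point $a\in\mathfrak c$ is regarded as a linear map $\mathbb C^4\to\Delta_+$, and $\gamma_a(x)=\gamma(a(x)^2)$. The lines $\overline{uv}\subset\mathbb P^3$ with $(\gamma_a(u),\gamma_a(v))=0$ form a quadratic complex: there is a quadratic form $\Theta$ on $\Lambda^2\mathbb C^4$ with $\Theta(u\wedge v)=(\gamma_a(u),\gamma_a(v))$ for all $u,v$. The associated Kummer quartic form $K_a$ on $(\mathbb C^4)^\vee$ is the discriminant form of this complex: for $u_0,u_1,u_2\in\mathbb C^4$ and the linear form $h=\det(u_0,u_1,u_2,\cdot)$, $K_a(h)$ is the determinant of the Gram matrix of $\Theta$ on $u_1\wedge u_2,\ u_2\wedge u_0,\ u_0\wedge u_1$. **Proposition.** There are linearly independent homogeneous polynomials $A,B,C,D,E$ of degree $12$ on $\mathfrak c$, spanning a five-dimensional space $V_5$, such that for every $a\in\mathfrak c$ the quartic $K_a$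 is in Hudson's canonical form, after rescaling two coordinates by an eighth root of unity: $K_a(x,y,z,t)=H_a(x,y,\zeta z,\zeta t)$ with $\zeta=e^{i\pi/4}$ and $$\begin{aligned}H_a(x,y,z,t)={}&A(a)(x^2y^2+z^2t^2)+B(a)(x^2z^2+y^2t^2)+C(a)(x^2t^2+y^2z^2)\\&+2D(a)xyzt+E(a)(x^4+y^4+z^4+t^4).\end{aligned}$$ The resulting rational map $K=[A:B:C:D:E]:\mathbb P(\mathfrak c)\dashrightarrow\mathbb P(V_5)\simeq\mathbb P^4$ is generically finite of degree $256$ (over a dense Zariski open subset of its image, each fibre consists of $256$ points). Its image (the Zariski closure of its set of values) is the cubic threefold $4E^3-(A^2+B^2+C^2-D^2)E+ABC=0$. This is projectively isomorphic to the Segre cubic $\mathrm S_3=\{\sum_{i=0}^5z_i=\sum_{i=0}^5z_i^3=0\}\subset\mathbb P^5$, and to the projective dual of the Castelnuovo--Richmond (Igusa) quartic $\mathrm{CR}_4=\{\sum_{i=0}^5x_i=(\sum_{i=0}^5x_i^2)^2-4\sum_{i=0}^5x_i^4=0\}$, viewed as a hypersurface in the hyperplane $\sum x_i=0$ of $\mathbb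 P^5$. -/

import Mathlib

open scoped LinearAlgebra.Projectivization

noncomputable section

namespace SpinorKummer

/-! ### Spinors of `Spin₁₀` and the Cartan subspace -/

/-- The maximal isotropic space `E = ⟨e₁, …, e₅⟩`; the vector `e_{i+1}` is `Pi.single i 1`. -/
abbrev E5 : Type := Fin 5 → ℂ

/-- The vector representation `V₁₀ = F ⊕ E` with `F = E^∨`.  Its invariant symmetric bilinear form
is `LinearMap.dualProd ℂ E5`, that is `((f, x), (g, y)) ↦ f y + g x`. -/
abbrev V10 : Type := Module.Dual ℂ E5 × E5

/-- The spinors `Λ E = Δ₊ ⊕ Δ₋` (even and odd part). -/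
abbrev Spinors : Type := ExteriorAlgebra ℂ E5

/-- Clifford multiplication of a spinor by `v = (f, x)`: exterior product by `x` plus contraction
by `f`. -/
def cliffordMul (v : V10) : Spinors →ₗ[ℂ] Spinors :=
  LinearMap.mulLeft ℂ (ExteriorAlgebra.ι ℂ v.2) + CliffordAlgebra.contractLeft v.1

/-- The coefficient of `e₁ ∧ e₂ ∧ e₃ ∧ e₄ ∧ e₅`. -/
def topCoeff : Spinors →ₗ[ℂ] ℂ :=
  ExteriorAlgebra.liftAlternating
    (Pi.single (M := fun i : ℕ => E5 [⋀^Fin i]→ₗ[ℂ] ℂ) 5 Matrix.detRowAlternating)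

/-- The spin-invariant pairing of spinors; it puts `Δ₊` and `Δ₋` in duality. -/
def spinPairing (η δ : Spinors) : ℂ := topCoeff (CliffordAlgebra.reverse η * δ)

/-- The equivariant map `γ : S²Δ₊ → V₁₀`, characterised by `(γ(δ, η), v) = ⟨η, v · δ⟩` for all
`v ∈ V₁₀`. -/
def gamma (δ η : Spinors) : V10 :=
  ((Fintype.linearCombination ℂ fun i : Fin 5 =>
      spinPairing η (cliffordMul (0, Pi.single i 1) δ)),
   fun i => spinPairing η (cliffordMul (LinearMap.proj i, 0) δ))

/-- The spinor `e_{i₁} ∧ ⋯ ∧ e_{i_k}` (with indices shifted by one: `mono [4, 2]` is `e₅ ∧ e₃`). -/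
def mono (l : List (Fin 5)) : Spinors :=
  (l.map fun i => ExteriorAlgebra.ι ℂ (Pi.single i 1 : E5)).prod

/-- The basis `p₁, …, p₄` of the Cartan subspace `𝔠 ⊂ ℂ⁴ ⊗ Δ₊`: in terms of the standard basis
`a₁, …, a₄` of `ℂ⁴`, the `i`-th element is `∑ₚ aₚ ⊗ cartanBasis i p`. -/
def cartanBasis : Fin 4 → Fin 4 → Spinors :=
  ![![mono [4, 2], mono [0, 1, 3, 4], mono [3, 1], mono [2, 0]],
    ![mono [4, 1], mono [0, 2, 3, 4], mono [2, 3], mono [0, 1]],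
    ![mono [0, 1, 2, 3], mono [], mono [0, 1, 2, 4], mono [4, 3]],
    ![mono [0, 3], mono [1, 2], mono [4, 0], mono [1, 2, 3, 4]]]

/-- The point `∑ aᵢ pᵢ` of the Cartan subspace, seen as a map from `ℂ⁴` to `Δ₊`. -/
def spinorMap (a x : Fin 4 → ℂ) : Spinors :=
  ∑ i, ∑ p, (a i * x p) • cartanBasis i p

/-- The quadratic map `γ_a : ℂ⁴ → V₁₀` attached to the point `∑ aᵢ pᵢ` of `𝔠`. -/
def gammaAt (a x : Fin 4 → ℂ) : V10 := gamma (spinorMap a x) (spinorMap a x)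

/-! ### The quadratic complex of lines and its Kummer quartic -/

/-- `Θ`, a quadric in `ℙ(Λ²ℂ⁴)`, cuts out on `G(2, 4)` the quadratic complex of lines of `a`: the
line joining `u` and `v` belongs to it when `γ_a(u)` and `γ_a(v)` are orthogonal. -/
def IsQuadraticComplex (a : Fin 4 → ℂ) (Θ : QuadraticForm ℂ (⋀[ℂ]^2 (Fin 4 → ℂ))) : Prop :=
  ∀ u v : Fin 4 → ℂ,
    Θ (exteriorPower.ιMulti ℂ 2 ![u, v]) = LinearMap.dualProd ℂ E5 (gammaAt a u) (gammaAt a v)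

/-- The restriction of `Θ` to the plane of lines contained in the plane spanned by
`u₀, u₁, u₂`, in the basis `u₁ ∧ u₂, u₂ ∧ u₀, u₀ ∧ u₁`. -/
def conic (Θ : QuadraticForm ℂ (⋀[ℂ]^2 (Fin 4 → ℂ))) (u : Fin 3 → Fin 4 → ℂ) :
    QuadraticForm ℂ (Fin 3 → ℂ) :=
  Θ.comp (Fintype.linearCombination ℂ
    ![exteriorPower.ιMulti ℂ 2 ![u 1, u 2], exteriorPower.ιMulti ℂ 2 ![u 2, u 0],
      exteriorPower.ιMulti ℂ 2 ![u 0, u 1]])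

/-- The equation `h` of the plane spanned by `u₀, u₁, u₂`: `h · w = det(u₀, u₁, u₂, w)`. -/
def planeEquation (u : Fin 3 → Fin 4 → ℂ) : Fin 4 → ℂ :=
  fun k => Matrix.det (Matrix.of ![u 0, u 1, u 2, Pi.single k 1])

/-- The quartic form `K` on the dual of `ℂ⁴` is the equation of the Kummer surface of `a`: at the
plane spanned by `u₀, u₁, u₂` it is the discriminant of the conic of lines of the complex which are
contained in that plane. -/
def IsKummerEquation (a : Fin 4 → ℂ) (K : (Fin 4 → ℂ) → ℂ) : Prop :=
  (∃ Θ, IsQuadraticComplex a Θ) ∧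
    ∀ Θ, IsQuadraticComplex a Θ → ∀ u, K (planeEquation u) = (conic Θ u).discr'

/-- Hudson's canonical form with coefficients `c = (A, B, C, D, E)`. -/
def hudsonQuartic (c : Fin 5 → ℂ) (x y z t : ℂ) : ℂ :=
  c 0 * (x ^ 2 * y ^ 2 + z ^ 2 * t ^ 2) + c 1 * (x ^ 2 * z ^ 2 + y ^ 2 * t ^ 2)
    + c 2 * (x ^ 2 * t ^ 2 + y ^ 2 * z ^ 2) + 2 * c 3 * (x * y * z * t)
    + c 4 * (x ^ 4 + y ^ 4 + z ^ 4 + t ^ 4)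

/-- A primitive eighth root of unity. -/
def zeta8 : ℂ := Complex.exp (Complex.I * (Real.pi / 4))

/-! ### Projective varieties and rational maps -/

/-- The locus in `ℙⁿ⁻¹` of common zeros of a set of homogeneous polynomials. -/
def zeroLocus {n : ℕ} (S : Set (MvPolynomial (Fin n) ℂ)) : Set (ℙ ℂ (Fin n → ℂ)) :=
  {p | ∀ F ∈ S, MvPolynomial.eval p.rep F = 0}

/-- The Zariski closure of a subset of `ℙⁿ⁻¹`. -/
def zariskiClosure {n : ℕ} (X : Set (ℙ ℂ (Fin n → ℂ))) : Set (ℙ ℂ (Fin n → ℂ)) :=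
  zeroLocus {F | (∃ d, F.IsHomogeneous d) ∧ ∀ q ∈ X, MvPolynomial.eval q.rep F = 0}

/-- The rational map `[f₀ : ⋯ : f_{m-1}]`, for homogeneous polynomials `fᵢ` of the same degree, is
defined at `p` and maps it to `y`. -/
def RatMapsTo {n m : ℕ} (f : Fin m → MvPolynomial (Fin n) ℂ)
    (p : ℙ ℂ (Fin n → ℂ)) (y : ℙ ℂ (Fin m → ℂ)) : Prop :=
  ∃ h : (fun i => MvPolynomial.eval p.rep (f i)) ≠ 0, Projectivization.mk ℂ _ h = y

/-- The image of a rational map: the Zariski closure of the set of its values. -/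
def ratImage {n m : ℕ} (f : Fin m → MvPolynomial (Fin n) ℂ) : Set (ℙ ℂ (Fin m → ℂ)) :=
  zariskiClosure {y | ∃ p, RatMapsTo f p y}

/-- The rational map is generically finite of degree `d`: over a dense Zariski open subset of its
image, each fibre consists of `d` points. -/
def IsGenericallyFiniteOfDegree {n m : ℕ} (f : Fin m → MvPolynomial (Fin n) ℂ) (d : ℕ) : Prop :=
  ∃ Z : Set (ℙ ℂ (Fin m → ℂ)), zariskiClosure Z = Z ∧
    zariskiClosure (ratImage f \ Z) = ratImage f ∧
    ∀ y ∈ ratImage f \ Z, {p | RatMapsTo f p y}.encard = d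

/-- `Y` is the image of `X` under an injective linear map of the underlying vector spaces. -/
def ProjectivelyIsomorphic {n m : ℕ} (X : Set (ℙ ℂ (Fin n → ℂ))) (Y : Set (ℙ ℂ (Fin m → ℂ))) :
    Prop :=
  ∃ (L : (Fin n → ℂ) →ₗ[ℂ] (Fin m → ℂ)) (hL : Function.Injective L),
    Projectivization.map L hL '' X = Y

/-- The projective dual of the hypersurface `F = 0`, for an irreducible form `F`: the Zariski
closure, in the dual projective space, of the set of tangent hyperplanes at smooth points. -/
def dualHypersurface {n : ℕ} (F : MvPolynomial (Fin n) ℂ) : Set (ℙ ℂ (Fin n → ℂ)) :=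
  zariskiClosure {h | ∃ v : Fin n → ℂ, MvPolynomial.eval v F = 0 ∧
    ∃ hv : (fun i => MvPolynomial.eval v (MvPolynomial.pderiv i F)) ≠ 0,
      Projectivization.mk ℂ _ hv = h}

/-! ### The Segre cubic and the Castelnuovo-Richmond quartic -/

open MvPolynomial in
/-- The cubic form `4E³ - (A² + B² + C² - D²)E + ABC` in the coefficients `(A, B, C, D, E)` of
Hudson's canonical form. -/
def hudsonCubic : MvPolynomial (Fin 5) ℂ :=
  4 * X 4 ^ 3 - (X 0 ^ 2 + X 1 ^ 2 + X 2 ^ 2 - X 3 ^ 2) * X 4 + X 0 * X 1 * X 2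

open MvPolynomial in
/-- The Segre cubic in `ℙ⁵`: `z₀ + ⋯ + z₅ = z₀³ + ⋯ + z₅³ = 0`. -/
def segreCubic : Set (ℙ ℂ (Fin 6 → ℂ)) :=
  zeroLocus {∑ i, X i, ∑ i, X i ^ 3}

open MvPolynomial in
/-- The equation of the Castelnuovo-Richmond (or Igusa) quartic
`x₀ + ⋯ + x₅ = (x₀² + ⋯ + x₅²)² - 4(x₀⁴ + ⋯ + x₅⁴) = 0`, in the coordinates `x₀, …, x₄` of the
hyperplane `x₀ + ⋯ + x₅ = 0`. -/
def castelnuovoRichmond : MvPolynomial (Fin 5) ℂ :=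
  (∑ i, X i ^ 2 + (-∑ i, X i) ^ 2) ^ 2 - 4 * (∑ i, X i ^ 4 + (-∑ i, X i) ^ 4)

end SpinorKummer

end

/-!
Everything is expressed through the five Heisenberg-invariant quartics `p = (G, B, D, b, c)` of a
point `a` of the Cartan subspace (`heisenbergQuartics`).

**The Kummer quartic.** Evaluating the Clifford product on monomials gives the map `γ_a` in
coordinates (`gammaAt_fst`, `gammaAt_snd`), hence the quadratic complex in Plücker coordinates
(`isQuadraticComplex_quadraticComplex`). By the Cauchy-Binet formula, the
discriminant of the conic of lines in a plane is quadratic in the triple products of the Plücker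
coordinates of these lines, and the triple products are quadratic in the equation of the plane
(`tripleProduct_lineColumn`, `det_gramEntry_lineColumn`). The result is Hudson's form
(`isKummerEquation`), with coefficients that are cubic polynomials in `p` (`hudsonCoefficients`).
They satisfy the equation of the cubic threefold identically in `p`.

**The degree.** The rational map `K` is the composition of `a ↦ p` and `p ↦ hudsonCoefficients p`,
and both maps contribute a factor `16`. The quartics `p` satisfy the relation `igusaQuartic p = 0`
and, conversely, a general point on it comes from sixteen points of `ℙ³`, which one finds by
extracting square roots twice (`exists_sixteen_points`). For the second map, read `p` as six Klein
coefficients up to translation, that is, as six points of the affine line. Its image `y` on the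
cubic threefold remembers the six points up to projective transformations only. Thus the points
over `y` arise by choosing the point `t` of `ℙ¹` that goes to infinity
(`exists_eq_smul_kleinCoefficients`, where one of the six points is put at infinity to begin with),
and the condition `igusaQuartic p = 0` becomes an equation for `t` of degree sixteen
(`fiberPolynomial`). It has simple roots, at which the sixteen points over `p` exist, unless a
certain resultant vanishes (`genericityPolynomial`), and for one explicit `y` it does not vanish
(`exists_sample_point`).

**The image.** The cubic threefold is irreducible, so what contains a non-empty open subset of it is
dense (`zariskiClosure_eq_hudsonCubic`). The isomorphism with the Segre cubic is an explicit linear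
change of coordinates (`hudsonCubic_projectivelyIsomorphic_segreCubic`). The gradient of the
Castelnuovo-Richmond quartic in the coordinates `xᵢ` has entries that are, by Newton's identities,
the coordinates of a point of the Segre cubic; in the other direction `xᵢ = zᵢ² - (∑ z_j²) / 6`
inverts this up to a factor for `z` on the Segre cubic, which identifies the dual variety
(`hudsonCubic_projectivelyIsomorphic_dualHypersurface`).
-/

namespace SpinorKummer

open MvPolynomial

/-! ### Projective zero loci -/

lemma eval_smul_of_isHomogeneous {σ : Type*} [Fintype σ] {d : ℕ} {F : MvPolynomial σ ℂ}
    (hF : F.IsHomogeneous d) (c : ℂ) (v : σ → ℂ) : eval (c • v) F = c ^ d * eval v F := by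
  rw [eval_eq, eval_eq, Finset.mul_sum]
  refine Finset.sum_congr rfl fun m hm => ?_
  have hd : m.degree = d := by
    rw [Finsupp.degree_eq_weight_one]
    exact hF (mem_support_iff.1 hm)
  have h1 : ∏ i ∈ m.support, c ^ m i = c ^ d := by
    rw [Finset.prod_pow_eq_pow_sum, ← hd, Finsupp.degree_apply]
  simp only [Pi.smul_apply, smul_eq_mul, mul_pow, Finset.prod_mul_distrib, h1]
  ring

lemma eval_rep_mk_eq_zero_iff {n d : ℕ} {F : MvPolynomial (Fin n) ℂ} (hF : F.IsHomogeneous d)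
    {v : Fin n → ℂ} (hv : v ≠ 0) :
    eval (Projectivization.mk ℂ v hv).rep F = 0 ↔ eval v F = 0 := by
  obtain ⟨a, ha⟩ := Projectivization.exists_smul_eq_mk_rep ℂ v hv
  rw [← ha, Units.smul_def, eval_smul_of_isHomogeneous hF]
  simp

lemma mk_mem_zeroLocus {n : ℕ} {S : Set (MvPolynomial (Fin n) ℂ)}
    (hS : ∀ F ∈ S, ∃ d, F.IsHomogeneous d) {v : Fin n → ℂ} (hv : v ≠ 0) :
    Projectivization.mk ℂ v hv ∈ zeroLocus S ↔ ∀ F ∈ S, eval v F = 0 := by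
  refine forall₂_congr fun F hF => ?_
  obtain ⟨d, hd⟩ := hS F hF
  exact eval_rep_mk_eq_zero_iff hd hv

lemma subset_zariskiClosure {n : ℕ} (X : Set (ℙ ℂ (Fin n → ℂ))) : X ⊆ zariskiClosure X :=
  fun _ hp _ hF => hF.2 _ hp

lemma zariskiClosure_mono {n : ℕ} {X Y : Set (ℙ ℂ (Fin n → ℂ))} (h : X ⊆ Y) :
    zariskiClosure X ⊆ zariskiClosure Y :=
  fun _ hp _ hF => hp _ ⟨hF.1, fun q hq => hF.2 q (h hq)⟩

lemma zariskiClosure_zeroLocus {n : ℕ} {S : Set (MvPolynomial (Fin n) ℂ)}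
    (hS : ∀ F ∈ S, ∃ d, F.IsHomogeneous d) : zariskiClosure (zeroLocus S) = zeroLocus S :=
  Set.Subset.antisymm (fun _ hp F hF => hp F ⟨hS F hF, fun _ hq => hq F hF⟩)
    (subset_zariskiClosure _)

/-! ### The cubic threefold is irreducible -/

lemma hudsonCubic_isHomogeneous : hudsonCubic.IsHomogeneous 3 := by
  have h4 : (4 : MvPolynomial (Fin 5) ℂ).IsHomogeneous 0 := isHomogeneous_C _ (4 : ℂ)
  have hX (i : Fin 5) : (X i : MvPolynomial (Fin 5) ℂ).IsHomogeneous 1 := isHomogeneous_X _ i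
  refine IsHomogeneous.add (IsHomogeneous.sub ?_ ?_) ?_
  · exact h4.mul ((hX 4).pow 3)
  · exact ((((hX 0).pow 2).add ((hX 1).pow 2)).add ((hX 2).pow 2)).sub ((hX 3).pow 2) |>.mul (hX 4)
  · exact ((hX 0).mul (hX 1)).mul (hX 2)

lemma eval_hudsonCubic (y : Fin 5 → ℂ) :
    eval y hudsonCubic =
      4 * y 4 ^ 3 - (y 0 ^ 2 + y 1 ^ 2 + y 2 ^ 2 - y 3 ^ 2) * y 4 + y 0 * y 1 * y 2 := by
  simp [hudsonCubic]

lemma isRelPrime_of_eval {n : ℕ} {f g : MvPolynomial (Fin n) ℂ} (hf : Irreducible f)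
    (v : Fin n → ℂ) (h1 : eval v f = 0) (h2 : eval v g ≠ 0) : IsRelPrime f g := by
  rw [hf.isRelPrime_iff_not_dvd]
  rintro ⟨k, rfl⟩
  simp [h1] at h2

lemma bind₁_ofNat {σ τ : Type*} (f : σ → MvPolynomial τ ℂ) (k : ℕ) [k.AtLeastTwo] :
    bind₁ f (ofNat(k) : MvPolynomial σ ℂ) = ofNat(k) :=
  map_ofNat _ k

/-- The coordinate change `(x₁, x₂, x₃, u, E) ↦ (A, B, C, D, E)` with `A = x₁ - 2E`,
`B = x₂ - 2E`, `C = x₃ - 2E` and `D = x₁ + x₂ + x₃ - 4E - u`. -/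
noncomputable def linearCoordinates : MvPolynomial (Fin 5) ℂ ≃ₐ[ℂ] MvPolynomial (Fin 5) ℂ :=
  AlgEquiv.ofAlgHom
    (aeval ![X 0 - 2 * X 4, X 1 - 2 * X 4, X 2 - 2 * X 4,
      X 0 + X 1 + X 2 - 4 * X 4 - X 3, X 4])
    (aeval ![X 0 + 2 * X 4, X 1 + 2 * X 4, X 2 + 2 * X 4,
      X 0 + X 1 + X 2 + 2 * X 4 - X 3, X 4])
    (by
      refine algHom_ext fun i => ?_
      fin_cases i <;> simp [bind₁_ofNat]
      ring)
    (by
      refine algHom_ext fun i => ?_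
      fin_cases i <;> simp [bind₁_ofNat]
      ring)

/-- In suitable coordinates the cubic takes the form `x₁x₂x₃ - u u' E` with `u'` another linear
form, which has degree one in `x₁`. -/
lemma linearCoordinates_hudsonCubic :
    linearCoordinates hudsonCubic =
      (X 2 * X 1 + -(2 * X 3 * X 4)) * X 0 +
        -(X 3 * X 4 * (2 * X 1 + 2 * X 2 - 8 * X 4 - X 3)) := by
  simp [linearCoordinates, hudsonCubic, bind₁_ofNat]
  ring

lemma notMem_vars_of_mem_supported {i : Fin 5} {s : Set (Fin 5)} {f : MvPolynomial (Fin 5) ℂ}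
    (hf : f ∈ supported ℂ s) (hi : i ∉ s) : i ∉ f.vars :=
  fun h => hi (mem_supported.1 hf h)

lemma hudsonCubic_irreducible : Irreducible hudsonCubic := by
  rw [← MulEquiv.irreducible_iff linearCoordinates, linearCoordinates_hudsonCubic]
  have hX {i : Fin 5} {s : Set (Fin 5)} (hi : i ∈ s) :
      (X i : MvPolynomial (Fin 5) ℂ) ∈ supported ℂ s := X_mem_supported.2 hi
  have h0 {s : Set (Fin 5)} (k : ℕ) [k.AtLeastTwo] :
      (ofNat(k) : MvPolynomial (Fin 5) ℂ) ∈ supported ℂ s := ofNat_mem _ _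
  have hf : Irreducible (X 2 * X 1 + -(2 * X 3 * X 4) : MvPolynomial (Fin 5) ℂ) := by
    refine irreducible_mul_X_add _ _ 1 (X_ne_zero 2) (by simp [vars_X]) ?_ ?_
    · refine notMem_vars_of_mem_supported (s := {3, 4}) ?_ (by simp)
      exact neg_mem (mul_mem (mul_mem (h0 2) (hX (by simp))) (hX (by simp)))
    · exact isRelPrime_of_eval (X_prime).irreducible ![0, 0, 0, 1, 1] (by simp) (by simp)
  refine irreducible_mul_X_add _ _ 0 hf.ne_zero ?_ ?_ ?_
  · refine notMem_vars_of_mem_supported (s := {0}ᶜ) ?_ (by simp)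
    exact add_mem (mul_mem (hX (by simp)) (hX (by simp)))
      (neg_mem (mul_mem (mul_mem (h0 2) (hX (by simp))) (hX (by simp))))
  · refine notMem_vars_of_mem_supported (s := {0}ᶜ) ?_ (by simp)
    exact neg_mem (mul_mem (mul_mem (hX (by simp)) (hX (by simp))) (sub_mem (sub_mem (add_mem
      (mul_mem (h0 2) (hX (by simp))) (mul_mem (h0 2) (hX (by simp))))
      (mul_mem (h0 8) (hX (by simp)))) (hX (by simp))))
  · exact isRelPrime_of_eval hf ![0, 1, 2, 1, 1] (by simp) (by simp; norm_num)

/-- Irreducibility of the cubic in geometric form: a polynomial that vanishes on the non-empty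
open subset `P ≠ 0` of the cubic vanishes on the whole cubic. -/
lemma eval_eq_zero_of_hudsonCubic {F P : MvPolynomial (Fin 5) ℂ}
    {y₀ : Fin 5 → ℂ} (hy₀ : eval y₀ hudsonCubic = 0) (hP : eval y₀ P ≠ 0)
    (h : ∀ y, eval y hudsonCubic = 0 → eval y P ≠ 0 → eval y F = 0) :
    ∀ y, eval y hudsonCubic = 0 → eval y F = 0 := by
  have hprime := hudsonCubic_irreducible.prime
  have hI := (Ideal.span_singleton_prime hprime.ne_zero).2 hprime
  have hFP : F * P ∈ vanishingIdeal ℂ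
      (MvPolynomial.zeroLocus ℂ (Ideal.span {hudsonCubic})) := by
    intro y hy
    have hy' : eval y hudsonCubic = 0 := hy _ (Ideal.mem_span_singleton_self _)
    by_cases hPy : eval y P = 0
    · simp [aeval_eq_eval, hPy]
    · simp [aeval_eq_eval, h y hy' hPy]
  rw [IsPrime.vanishingIdeal_zeroLocus, Ideal.mem_span_singleton] at hFP
  intro y hy
  rcases hprime.dvd_or_dvd hFP with ⟨k, rfl⟩ | ⟨k, rfl⟩
  · simp [hy]
  · simp [hy₀] at hP

/-- The closure of a part of the cubic that contains a non-empty Zariski open subset of it is the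
whole cubic. -/
lemma zariskiClosure_eq_hudsonCubic {U : Set (ℙ ℂ (Fin 5 → ℂ))}
    (hU : U ⊆ zeroLocus {hudsonCubic}) {P : MvPolynomial (Fin 5) ℂ}
    {y₀ : Fin 5 → ℂ} (hne : y₀ ≠ 0) (hy₀ : eval y₀ hudsonCubic = 0) (hP : eval y₀ P ≠ 0)
    (h : ∀ y (hy : y ≠ 0), eval y hudsonCubic = 0 → eval y P ≠ 0 →
      Projectivization.mk ℂ y hy ∈ U) :
    zariskiClosure U = zeroLocus {hudsonCubic} := by
  have hS : ∀ F ∈ ({hudsonCubic} : Set (MvPolynomial (Fin 5) ℂ)), ∃ d, F.IsHomogeneous d := by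
    rintro _ rfl
    exact ⟨3, hudsonCubic_isHomogeneous⟩
  refine Set.Subset.antisymm ?_ ?_
  · exact (zariskiClosure_mono hU).trans (zariskiClosure_zeroLocus hS).subset
  · rintro p hp F ⟨⟨d, hd⟩, hF⟩
    rw [← Projectivization.mk_rep p] at hp ⊢
    obtain ⟨i, hi⟩ := Function.ne_iff.1 hne
    have hp' := (mk_mem_zeroLocus hS p.rep_nonzero).1 hp _ rfl
    rw [eval_rep_mk_eq_zero_iff hd]
    -- the factor `X i` excludes the vertex of the affine cone
    refine eval_eq_zero_of_hudsonCubic (P := P * X i) hy₀ (by simpa using ⟨hP, hi⟩) ?_ _ hp'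
    intro y hy hPy
    simp only [map_mul, eval_X, ne_eq, mul_eq_zero, not_or] at hPy
    have hy0 : y ≠ 0 := fun h0 => hPy.2 (by simp [h0])
    exact (eval_rep_mk_eq_zero_iff hd hy0).1 (hF _ (h y hy0 hy hPy.1))

/-! ### The Segre cubic -/

/-- An injective linear map identifies two projective loci of homogeneous equations as soon as the
equations correspond to each other and the second locus is contained in its range. -/
lemma map_image_zeroLocus {n m : ℕ} {S : Set (MvPolynomial (Fin n) ℂ)}
    {T : Set (MvPolynomial (Fin m) ℂ)} (hS : ∀ F ∈ S, ∃ d, F.IsHomogeneous d)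
    (hT : ∀ F ∈ T, ∃ d, F.IsHomogeneous d) (L : (Fin n → ℂ) →ₗ[ℂ] (Fin m → ℂ))
    (hL : Function.Injective L)
    (h : ∀ v, (∀ F ∈ S, eval v F = 0) ↔ ∀ F ∈ T, eval (L v) F = 0)
    (hrange : ∀ w, (∀ F ∈ T, eval w F = 0) → ∃ v, L v = w) :
    Projectivization.map L hL '' zeroLocus S = zeroLocus T := by
  ext p
  induction p using Projectivization.ind with | h w hw
  rw [mk_mem_zeroLocus hT]
  constructor
  · rintro ⟨q, hq, hqw⟩
    induction q using Projectivization.ind with | h v hv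
    rw [mk_mem_zeroLocus hS, h] at hq
    rw [Projectivization.map_mk, Projectivization.mk_eq_mk_iff'] at hqw
    obtain ⟨a, ha⟩ := hqw
    have ha0 : a ≠ 0 := by
      rintro rfl
      rw [zero_smul] at ha
      exact hv (hL (by rw [← ha, map_zero]))
    intro F hF
    obtain ⟨d, hd⟩ := hT F hF
    have := hq F hF
    rw [← ha, eval_smul_of_isHomogeneous hd] at this
    simpa [ha0] using this
  · intro hF
    obtain ⟨v, rfl⟩ := hrange w hF
    have hv : v ≠ 0 := fun h0 => hw (by simp [h0])
    exact ⟨Projectivization.mk ℂ v hv, (mk_mem_zeroLocus hS hv).2 ((h v).2 hF), by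
      rw [Projectivization.map_mk]⟩

/-- The linear map to `ℂ⁶` that turns the coefficients `(A, B, C, D, E)` of Hudson's form into the
symmetric coordinates of the Segre cubic. -/
noncomputable def segreCoordinates : (Fin 5 → ℂ) →ₗ[ℂ] (Fin 6 → ℂ) :=
  Matrix.mulVecLin !![0, 0, 0, 1, 4; 0, 0, 0, -1, 4; -1, -1, 1, 0, -2; -1, 1, -1, 0, -2;
    1, -1, -1, 0, -2; 1, 1, 1, 0, -2]

lemma segreCoordinates_apply (y : Fin 5 → ℂ) :
    segreCoordinates y = ![4 * y 4 + y 3, 4 * y 4 - y 3, -y 0 - y 1 + y 2 - 2 * y 4,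
      -y 0 + y 1 - y 2 - 2 * y 4, y 0 - y 1 - y 2 - 2 * y 4, y 0 + y 1 + y 2 - 2 * y 4] := by
  ext i
  fin_cases i <;> simp [segreCoordinates, Matrix.mulVec, dotProduct, Fin.sum_univ_succ] <;> ring

lemma segreCoordinates_injective : Function.Injective segreCoordinates := by
  rw [← LinearMap.ker_eq_bot, LinearMap.ker_eq_bot']
  intro y hy
  rw [segreCoordinates_apply] at hy
  have h0 := congrFun hy 0
  have h1 := congrFun hy 1
  have h3 := congrFun hy 3
  have h4 := congrFun hy 4
  have h5 := congrFun hy 5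
  simp at h0 h1 h3 h4 h5
  have e4 : y 4 = 0 := by linear_combination h0 / 8 + h1 / 8
  ext i
  fin_cases i <;> simp
  · linear_combination h4 / 2 + h5 / 2 + 2 * e4
  · linear_combination h3 / 2 + h5 / 2 + 2 * e4
  · linear_combination -h4 / 2 - h3 / 2 - 2 * e4
  · linear_combination h0 / 2 - h1 / 2
  · exact e4

lemma sum_segreCoordinates (y : Fin 5 → ℂ) : ∑ i, segreCoordinates y i = 0 := by
  rw [segreCoordinates_apply]
  simp [Fin.sum_univ_succ]
  ring

lemma sum_segreCoordinates_pow_three (y : Fin 5 → ℂ) :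
    ∑ i, segreCoordinates y i ^ 3 = 24 * eval y hudsonCubic := by
  rw [segreCoordinates_apply, eval_hudsonCubic]
  simp [Fin.sum_univ_succ]
  ring

lemma exists_segreCoordinates_eq {z : Fin 6 → ℂ} (hz : ∑ i, z i = 0) :
    ∃ y, segreCoordinates y = z := by
  refine ⟨![(z 4 + z 5) / 2 + (z 0 + z 1) / 4, (z 3 + z 5) / 2 + (z 0 + z 1) / 4,
    (z 2 + z 5) / 2 + (z 0 + z 1) / 4, (z 0 - z 1) / 2, (z 0 + z 1) / 8], ?_⟩
  rw [segreCoordinates_apply]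
  simp only [Fin.sum_univ_succ] at hz
  ext i
  fin_cases i <;> simp at hz ⊢
  · ring
  · ring
  · linear_combination -hz / 2
  · linear_combination -hz / 2
  · linear_combination -hz / 2
  · linear_combination hz / 2

lemma hudsonCubic_projectivelyIsomorphic_segreCubic :
    ProjectivelyIsomorphic (zeroLocus {hudsonCubic}) segreCubic := by
  refine ⟨segreCoordinates, segreCoordinates_injective, map_image_zeroLocus ?_ ?_ _ _ ?_ ?_⟩
  · rintro _ rfl
    exact ⟨3, hudsonCubic_isHomogeneous⟩
  · rintro _ (rfl | rfl)
    · exact ⟨1, IsHomogeneous.sum _ _ _ fun i _ => isHomogeneous_X _ i⟩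
    · exact ⟨3, IsHomogeneous.sum _ _ _ fun i _ => isHomogeneous_X_pow i 3⟩
  · intro v
    simp [sum_segreCoordinates, sum_segreCoordinates_pow_three]
  · intro w hw
    exact exists_segreCoordinates_eq (by simpa using hw _ (Set.mem_insert _ _))

/-! ### The dual of the Castelnuovo-Richmond quartic -/

/-- Taking Zariski closures commutes with injective linear maps, in one direction. -/
lemma map_image_zariskiClosure_subset {n m : ℕ} (L : (Fin n → ℂ) →ₗ[ℂ] (Fin m → ℂ))
    (hL : Function.Injective L) (U : Set (ℙ ℂ (Fin n → ℂ))) :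
    Projectivization.map L hL '' zariskiClosure U ⊆
      zariskiClosure (Projectivization.map L hL '' U) := by
  rintro _ ⟨p, hp, rfl⟩ F ⟨⟨d, hd⟩, hF⟩
  set g : Fin m → MvPolynomial (Fin n) ℂ := fun i => ∑ j, C (L (Pi.single j 1) i) * X j with hg
  have hgh (i : Fin m) : (g i).IsHomogeneous 1 :=
    IsHomogeneous.sum _ _ _ fun j _ => isHomogeneous_C_mul_X _ j
  have hG : (aeval g F).IsHomogeneous d := by simpa using hd.aeval g hgh
  have heval (v : Fin n → ℂ) : eval v (aeval g F) = eval (L v) F := by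
    have h1 : (fun i => eval v (g i)) = L v := by
      ext i
      have h2 : v = ∑ j, v j • (Pi.single j 1 : Fin n → ℂ) := by
        ext k
        simp [Pi.single_apply]
      conv_rhs => rw [h2]
      simp [hg, mul_comm]
    rw [← h1, ← aeval_eq_eval, ← aeval_eq_eval, ← AlgHom.comp_apply, comp_aeval]
  have hmap (v : Fin n → ℂ) (hv : v ≠ 0) :
      eval (Projectivization.map L hL (Projectivization.mk ℂ v hv)).rep F = 0 ↔
        eval v (aeval g F) = 0 := by
    rw [Projectivization.map_mk, eval_rep_mk_eq_zero_iff hd, heval]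
  have key := hp (aeval g F) ⟨⟨d, hG⟩, fun q hq => ?_⟩
  · rw [← hmap _ p.rep_nonzero, Projectivization.mk_rep] at key
    exact key
  · rw [← hmap _ q.rep_nonzero, Projectivization.mk_rep]
    exact hF _ ⟨q, hq, rfl⟩

/-- The point with coordinate sum zero in `ℂ⁶` whose first five coordinates are given. -/
def completeSum (v : Fin 5 → ℂ) : Fin 6 → ℂ :=
  ![v 0, v 1, v 2, v 3, v 4, -(v 0 + v 1 + v 2 + v 3 + v 4)]

/-- The `k`-th power sum of six numbers. -/
def powerSum (k : ℕ) (x : Fin 6 → ℂ) : ℂ := ∑ i, x i ^ k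

/-- A quarter of the gradient of the Castelnuovo-Richmond quartic `p₂² - 4p₄` on `ℂ⁶`, projected to
the hyperplane `∑ zᵢ = 0`. -/
noncomputable def quarticGradient (x : Fin 6 → ℂ) : Fin 6 → ℂ :=
  fun i => powerSum 2 x * x i - 4 * x i ^ 3 + 2 / 3 * powerSum 3 x

/-- A third of the gradient of the Segre cubic `p₃` on `ℂ⁶`, projected to the hyperplane
`∑ xᵢ = 0`. -/
noncomputable def cubicGradient (z : Fin 6 → ℂ) : Fin 6 → ℂ := fun i => z i ^ 2 - powerSum 2 z / 6

lemma eval_castelnuovoRichmond (v : Fin 5 → ℂ) :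
    eval v castelnuovoRichmond =
      powerSum 2 (completeSum v) ^ 2 - 4 * powerSum 4 (completeSum v) := by
  simp [castelnuovoRichmond, powerSum, completeSum, Fin.sum_univ_succ]
  ring

lemma eval_pderiv_castelnuovoRichmond (v : Fin 5 → ℂ) (i : Fin 5) :
    eval v (pderiv i castelnuovoRichmond) =
      4 * (quarticGradient (completeSum v) i.castSucc - quarticGradient (completeSum v) 5) := by
  have h4 : pderiv i (4 : MvPolynomial (Fin 5) ℂ) = 0 := pderiv_C (a := (4 : ℂ))
  fin_cases i <;>
  · simp [castelnuovoRichmond, powerSum, completeSum, Fin.sum_univ_succ, quarticGradient,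
      pderiv_X, Derivation.leibniz_pow] at h4 ⊢
    simp [h4]
    ring

/-- Newton's identities for six numbers with sum zero: they are the roots of a polynomial
`T⁶ + e₂T⁴ - e₃T³ + e₄T² - e₅T + e₆`, which determines their power sums. -/
lemma exists_newton {x : Fin 6 → ℂ} (hx : ∑ i, x i = 0) :
    ∃ e₂ e₃ e₄ e₅ e₆ : ℂ, powerSum 1 x = 0 ∧ powerSum 2 x = -2 * e₂ ∧ powerSum 3 x = 3 * e₃ ∧
      powerSum 4 x = 2 * e₂ ^ 2 - 4 * e₄ ∧ powerSum 5 x = 5 * e₅ - 5 * e₂ * e₃ ∧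
      ∀ i, x i ^ 6 = -e₂ * x i ^ 4 + e₃ * x i ^ 3 - e₄ * x i ^ 2 + e₅ * x i - e₆ := by
  set e₂ := -powerSum 2 x / 2 with h₂
  set e₃ := powerSum 3 x / 3 with h₃
  set e₄ := (2 * e₂ ^ 2 - powerSum 4 x) / 4 with h₄
  set e₅ := (powerSum 5 x + 5 * e₂ * e₃) / 5 with h₅
  refine ⟨e₂, e₃, e₄, e₅, x 0 * x 1 * x 2 * x 3 * x 4 * x 5, by simpa [powerSum] using hx,
    by rw [h₂]; ring, by rw [h₃]; ring, by rw [h₄]; ring, by rw [h₅]; ring, ?_⟩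
  have h5 : x 5 = -(x 0 + x 1 + x 2 + x 3 + x 4) := by
    rw [Fin.sum_univ_six] at hx
    linear_combination hx
  intro i
  simp only [h₂, h₃, h₄, h₅, powerSum, Fin.sum_univ_six, h5]
  fin_cases i <;> simp only [Fin.isValue, Fin.reduceFinMk, Fin.zero_eta, Fin.mk_one, h5] <;> ring

/-- The power sums in degrees above five follow from the equation of the six numbers. -/
lemma powerSum_add_six {x : Fin 6 → ℂ} {e₂ e₃ e₄ e₅ e₆ : ℂ}
    (h : ∀ i, x i ^ 6 = -e₂ * x i ^ 4 + e₃ * x i ^ 3 - e₄ * x i ^ 2 + e₅ * x i - e₆) (k : ℕ) :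
    powerSum (k + 6) x = -e₂ * powerSum (k + 4) x + e₃ * powerSum (k + 3) x
      - e₄ * powerSum (k + 2) x + e₅ * powerSum (k + 1) x - e₆ * powerSum k x := by
  simp only [powerSum, Finset.mul_sum, ← Finset.sum_add_distrib, ← Finset.sum_sub_distrib]
  refine Finset.sum_congr rfl fun i _ => ?_
  rw [pow_add, h i]
  ring

lemma powerSum_zero (x : Fin 6 → ℂ) : powerSum 0 x = 6 := by
  simp [powerSum]

lemma powerSum_three_cubic (x : Fin 6 → ℂ) (a b : ℂ) :
    powerSum 3 (fun i => a * x i - 4 * x i ^ 3 + b) =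
      a ^ 3 * powerSum 3 x - 12 * a ^ 2 * powerSum 5 x + 48 * a * powerSum 7 x
        - 64 * powerSum 9 x
        + 3 * b * (a ^ 2 * powerSum 2 x - 8 * a * powerSum 4 x + 16 * powerSum 6 x)
        + 3 * b ^ 2 * (a * powerSum 1 x - 4 * powerSum 3 x) + b ^ 3 * powerSum 0 x := by
  simp only [powerSum, Fin.sum_univ_six]
  ring

lemma powerSum_quadratic (x : Fin 6 → ℂ) (b : ℂ) :
    powerSum 2 (fun i => x i ^ 2 + b) =
        powerSum 4 x + 2 * b * powerSum 2 x + b ^ 2 * powerSum 0 x ∧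
      powerSum 3 (fun i => x i ^ 2 + b) =
        powerSum 6 x + 3 * b * powerSum 4 x + 3 * b ^ 2 * powerSum 2 x + b ^ 3 * powerSum 0 x ∧
      powerSum 4 (fun i => x i ^ 2 + b) =
        powerSum 8 x + 4 * b * powerSum 6 x + 6 * b ^ 2 * powerSum 4 x + 4 * b ^ 3 * powerSum 2 x
          + b ^ 4 * powerSum 0 x := by
  simp only [powerSum, Fin.sum_univ_six]
  refine ⟨?_, ?_, ?_⟩ <;> ring

/-- The tangent hyperplanes of the Castelnuovo-Richmond quartic lie on the Segre cubic. -/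
lemma powerSum_three_quarticGradient {x : Fin 6 → ℂ} (hx : ∑ i, x i = 0)
    (h : powerSum 2 x ^ 2 - 4 * powerSum 4 x = 0) : powerSum 3 (quarticGradient x) = 0 := by
  obtain ⟨e₂, e₃, e₄, e₅, e₆, h1, h2, h3, h4, h5, h6⟩ := exists_newton hx
  have r6 := powerSum_add_six h6 0
  have r7 := powerSum_add_six h6 1
  have r9 := powerSum_add_six h6 3
  simp only [zero_add, Nat.reduceAdd, powerSum_zero, h1, h2, h3, h4, h5] at r6 r7 r9
  unfold quarticGradient
  rw [powerSum_three_cubic, powerSum_zero, r9, r7, r6, h1, h2, h3, h4, h5]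
  rw [h2, h4] at h
  linear_combination (36 * e₅ - 18 * e₂ * e₃) * h

lemma sum_cubicGradient (z : Fin 6 → ℂ) : ∑ i, cubicGradient z i = 0 := by
  simp [cubicGradient, powerSum]
  ring

/-- The tangent hyperplanes of the Segre cubic lie on the Castelnuovo-Richmond quartic. -/
lemma powerSum_cubicGradient {z : Fin 6 → ℂ} (hz : ∑ i, z i = 0) (h : powerSum 3 z = 0) :
    powerSum 2 (cubicGradient z) ^ 2 - 4 * powerSum 4 (cubicGradient z) = 0 := by
  obtain ⟨e₂, e₃, e₄, e₅, e₆, h1, h2, h3, h4, h5, h6⟩ := exists_newton hz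
  obtain rfl : e₃ = 0 := by simpa [h] using h3
  have r6 := powerSum_add_six h6 0
  have r8 := powerSum_add_six h6 2
  simp only [zero_add, Nat.reduceAdd, powerSum_zero, h1, h2, h3, h4, h5] at r6 r8
  obtain ⟨q2, -, q4⟩ := powerSum_quadratic z (-(powerSum 2 z / 6))
  unfold cubicGradient
  simp only [sub_eq_add_neg]
  rw [q2, q4, powerSum_zero, r8, r6, h2, h4]
  ring

/-- Biduality: the Gauss map of the quartic inverts the Gauss map of the Segre cubic, up to the
factor `p₅`. -/
lemma quarticGradient_cubicGradient {z : Fin 6 → ℂ} (hz : ∑ i, z i = 0) (h : powerSum 3 z = 0)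
    (i : Fin 6) :
    quarticGradient (cubicGradient z) i = -4 / 5 * powerSum 5 z * z i := by
  obtain ⟨e₂, e₃, e₄, e₅, e₆, h1, h2, h3, h4, h5, h6⟩ := exists_newton hz
  obtain rfl : e₃ = 0 := by simpa [h] using h3
  have r6 := powerSum_add_six h6 0
  simp only [zero_add, powerSum_zero, h1, h2, h3, h4] at r6
  obtain ⟨q2, q3, -⟩ := powerSum_quadratic z (-(powerSum 2 z / 6))
  unfold cubicGradient quarticGradient
  simp only [sub_eq_add_neg]
  rw [q2, q3, powerSum_zero, r6, h2, h4, h5]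
  linear_combination (-4) * h6 i

lemma completeSum_castSucc {x : Fin 6 → ℂ} (hx : ∑ i, x i = 0) :
    completeSum (fun i => x i.castSucc) = x := by
  rw [Fin.sum_univ_six] at hx
  ext i
  fin_cases i <;> simp [completeSum]
  linear_combination -hx

lemma sum_completeSum (v : Fin 5 → ℂ) : ∑ i, completeSum v i = 0 := by
  simp [completeSum, Fin.sum_univ_six]

lemma sum_quarticGradient {x : Fin 6 → ℂ} (hx : ∑ i, x i = 0) :
    ∑ i, quarticGradient x i = 0 := by
  simp only [quarticGradient, Finset.sum_add_distrib, Finset.sum_sub_distrib, ← Finset.mul_sum,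
    hx, powerSum]
  simp
  ring

/-- The coordinates `zᵢ - z₅` on the dual of the hyperplane `∑ xᵢ = 0` in `ℂ⁶`, for the symmetric
coordinates `zᵢ` of the Segre cubic. -/
noncomputable def dualCoordinates : (Fin 5 → ℂ) →ₗ[ℂ] (Fin 5 → ℂ) :=
  LinearMap.pi fun i =>
    (LinearMap.proj (R := ℂ) (φ := fun _ : Fin 6 => ℂ) i.castSucc - LinearMap.proj 5) ∘ₗ
      segreCoordinates

lemma dualCoordinates_apply (y : Fin 5 → ℂ) (i : Fin 5) :
    dualCoordinates y i = segreCoordinates y i.castSucc - segreCoordinates y 5 := rfl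

/-- A vector with coordinate sum zero is determined by the differences of its coordinates. -/
lemma eq_of_sub_eq {z x : Fin 6 → ℂ} (hz : ∑ i, z i = 0) (hx : ∑ i, x i = 0)
    (h : ∀ i : Fin 5, z i.castSucc - z 5 = x i.castSucc - x 5) : z = x := by
  rw [Fin.sum_univ_six] at hz hx
  have h0 := h 0
  have h1 := h 1
  have h2 := h 2
  have h3 := h 3
  have h4 := h 4
  simp only [Fin.isValue, Fin.castSucc_zero, Fin.castSucc_one, Fin.reduceCastSucc] at h0 h1 h2 h3 h4
  have h5 : z 5 = x 5 := by linear_combination (hz - hx - h0 - h1 - h2 - h3 - h4) / 6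
  ext i
  refine Fin.lastCases h5 (fun j => ?_) i
  linear_combination h j + h5

lemma dualCoordinates_injective : Function.Injective dualCoordinates := by
  intro y y' h
  refine segreCoordinates_injective (eq_of_sub_eq (sum_segreCoordinates _)
    (sum_segreCoordinates _) fun i => ?_)
  rw [← dualCoordinates_apply, ← dualCoordinates_apply, h]

/-- The fifth power sum in the symmetric coordinates of the Segre cubic. -/
noncomputable def segrePowerSumFive : MvPolynomial (Fin 5) ℂ :=
  (4 * X 4 + X 3) ^ 5 + (4 * X 4 - X 3) ^ 5 + (-X 0 - X 1 + X 2 - 2 * X 4) ^ 5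
    + (-X 0 + X 1 - X 2 - 2 * X 4) ^ 5 + (X 0 - X 1 - X 2 - 2 * X 4) ^ 5
    + (X 0 + X 1 + X 2 - 2 * X 4) ^ 5

lemma eval_segrePowerSumFive (y : Fin 5 → ℂ) :
    eval y segrePowerSumFive = powerSum 5 (segreCoordinates y) := by
  rw [segreCoordinates_apply]
  simp [segrePowerSumFive, powerSum, Fin.sum_univ_six]

lemma pderiv_castelnuovoRichmond_cubicGradient {y : Fin 5 → ℂ} (hy : eval y hudsonCubic = 0) :
    eval (fun i : Fin 5 => cubicGradient (segreCoordinates y) i.castSucc) castelnuovoRichmond = 0 ∧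
    (fun i => eval (fun i : Fin 5 => cubicGradient (segreCoordinates y) i.castSucc)
      (pderiv i castelnuovoRichmond)) =
        (-16 / 5 * powerSum 5 (segreCoordinates y)) • dualCoordinates y := by
  have h3 : powerSum 3 (segreCoordinates y) = 0 := by
    rw [powerSum, sum_segreCoordinates_pow_three, hy, mul_zero]
  constructor
  · rw [eval_castelnuovoRichmond, completeSum_castSucc (sum_cubicGradient _)]
    exact powerSum_cubicGradient (sum_segreCoordinates y) h3
  · ext i
    rw [eval_pderiv_castelnuovoRichmond, completeSum_castSucc (sum_cubicGradient _),
      quarticGradient_cubicGradient (sum_segreCoordinates y) h3,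
      quarticGradient_cubicGradient (sum_segreCoordinates y) h3, Pi.smul_apply,
      dualCoordinates_apply, smul_eq_mul]
    ring

lemma hudsonCubic_of_pderiv_castelnuovoRichmond {v y : Fin 5 → ℂ} {a : ℂ}
    (hv : eval v castelnuovoRichmond = 0)
    (h : a • (fun i => eval v (pderiv i castelnuovoRichmond)) = dualCoordinates y) :
    eval y hudsonCubic = 0 := by
  have hsum := sum_quarticGradient (sum_completeSum v)
  have hz : segreCoordinates y = fun i => 4 * a * quarticGradient (completeSum v) i := by
    refine eq_of_sub_eq (sum_segreCoordinates y) ?_ fun i => ?_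
    · rw [← Finset.mul_sum, hsum, mul_zero]
    · rw [← dualCoordinates_apply, ← h, Pi.smul_apply, eval_pderiv_castelnuovoRichmond, smul_eq_mul]
      ring
  have h3 := powerSum_three_quarticGradient (sum_completeSum v)
    (by rw [← eval_castelnuovoRichmond, hv])
  have h24 := sum_segreCoordinates_pow_three y
  rw [hz] at h24
  simp only [mul_pow, ← Finset.mul_sum] at h24
  rw [powerSum] at h3
  rw [h3] at h24
  linear_combination -h24 / 24

lemma hudsonCubic_projectivelyIsomorphic_dualHypersurface :
    ProjectivelyIsomorphic (zeroLocus {hudsonCubic}) (dualHypersurface castelnuovoRichmond) := by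
  have hinj := dualCoordinates_injective
  refine ⟨dualCoordinates, hinj, ?_⟩
  set e := LinearEquiv.ofInjectiveEndo dualCoordinates hinj with he
  have hmap (p) : Projectivization.map dualCoordinates hinj
      (Projectivization.map e.symm.toLinearMap e.symm.injective p) = p := by
    induction p using Projectivization.ind with | h v hv
    simp only [Projectivization.map_mk]
    congr 1
    exact e.apply_symm_apply v
  set T : Set (ℙ ℂ (Fin 5 → ℂ)) := {h | ∃ v : Fin 5 → ℂ, eval v castelnuovoRichmond = 0 ∧
    ∃ hv : (fun i => eval v (pderiv i castelnuovoRichmond)) ≠ 0,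
      Projectivization.mk ℂ _ hv = h} with hT
  have hdual : dualHypersurface castelnuovoRichmond = zariskiClosure T := rfl
  set U := Projectivization.map dualCoordinates hinj ⁻¹' T with hU
  have hclosure : zariskiClosure U = zeroLocus {hudsonCubic} := by
    refine zariskiClosure_eq_hudsonCubic (P := segrePowerSumFive) (y₀ := ![0, 0, 5, 3, -2])
      ?_ (fun h => ?_) ?_ ?_ ?_
    · intro p hp
      induction p using Projectivization.ind with | h y hy
      obtain ⟨v, hv, hv0, h⟩ := hp
      rw [Projectivization.map_mk, eq_comm, Projectivization.mk_eq_mk_iff'] at h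
      obtain ⟨a, ha⟩ := h
      rintro _ rfl
      rw [eval_rep_mk_eq_zero_iff hudsonCubic_isHomogeneous]
      exact hudsonCubic_of_pderiv_castelnuovoRichmond hv ha
    · simpa using congrFun h 2
    · simp [eval_hudsonCubic]
      norm_num
    · simp [segrePowerSumFive]
      norm_num
    · intro y hy hy3 hy5
      rw [eval_segrePowerSumFive] at hy5
      obtain ⟨h1, h2⟩ := pderiv_castelnuovoRichmond_cubicGradient hy3
      have hne : dualCoordinates y ≠ 0 := fun h0 => hy (hinj (by rw [h0, map_zero]))
      have hc : -16 / 5 * powerSum 5 (segreCoordinates y) ≠ 0 :=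
        mul_ne_zero (by norm_num) hy5
      refine ⟨_, h1, by rw [h2]; exact smul_ne_zero hc hne, ?_⟩
      rw [Projectivization.map_mk, Projectivization.mk_eq_mk_iff']
      exact ⟨_, h2.symm⟩
  rw [hdual, ← hclosure]
  refine Set.Subset.antisymm ?_ ?_
  · exact (map_image_zariskiClosure_subset _ hinj _).trans
      (zariskiClosure_mono (Set.image_preimage_subset _ _))
  · intro p hp
    refine ⟨Projectivization.map e.symm.toLinearMap e.symm.injective p, ?_, hmap p⟩
    refine zariskiClosure_mono ?_ (map_image_zariskiClosure_subset e.symm.toLinearMap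
      e.symm.injective _ ⟨p, hp, rfl⟩)
    rintro _ ⟨q, hq, rfl⟩
    rw [hU, Set.mem_preimage, hmap]
    exact hq

end SpinorKummer

namespace SpinorKummer

/-! ### Clifford multiplication on monomials -/

lemma mono_cons (i : Fin 5) (l : List (Fin 5)) :
    mono (i :: l) = ExteriorAlgebra.ι ℂ (Pi.single i 1 : E5) * mono l := by
  simp [mono]

lemma mono_append (l l' : List (Fin 5)) : mono (l ++ l') = mono l * mono l' := by
  simp [mono]

lemma reverse_mono (l : List (Fin 5)) : CliffordAlgebra.reverse (mono l) = mono l.reverse := by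
  induction l with
  | nil => simp [mono]
  | cons i l ih =>
    rw [mono_cons, CliffordAlgebra.reverse.map_mul, ih, List.reverse_cons, mono_append]
    congr 1
    simp only [mono, List.map_cons, List.map_nil, List.prod_cons, List.prod_nil, mul_one]
    exact CliffordAlgebra.reverse_ι _

/-- Insertion of an index into an increasing list: the sign of the permutation (zero if the index is
present) and the new list. -/
def insertSign (i : Fin 5) : List (Fin 5) → ℤ × List (Fin 5)
  | [] => (1, [i])
  | j :: l =>
    if i < j then (1, i :: j :: l)
    else if i = j then (0, [])
    else (-(insertSign i l).1, j :: (insertSign i l).2)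

/-- The sign of the permutation that sorts a list of indices (zero if there is a repetition) and the
sorted list. -/
def sortSign : List (Fin 5) → ℤ × List (Fin 5)
  | [] => (1, [])
  | i :: l => ((sortSign l).1 * (insertSign i (sortSign l).2).1, (insertSign i (sortSign l).2).2)

/-- The coefficient of `e₁ ∧ ⋯ ∧ e₅` in a monomial. -/
def topSign (l : List (Fin 5)) : ℤ :=
  if (sortSign l).2 = [0, 1, 2, 3, 4] then (sortSign l).1 else 0

lemma mono_cons_eq_insertSign (i : Fin 5) (l : List (Fin 5)) :
    mono (i :: l) = (insertSign i l).1 • mono (insertSign i l).2 := by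
  induction l with
  | nil => simp [insertSign]
  | cons j l ih =>
    rw [insertSign]
    split_ifs with h1 h2
    · simp
    · subst h2
      rw [mono_cons, mono_cons, ← mul_assoc, ExteriorAlgebra.ι_sq_zero]
      simp
    · have h : ExteriorAlgebra.ι ℂ (Pi.single i 1 : E5) * ExteriorAlgebra.ι ℂ (Pi.single j 1 : E5) =
          -(ExteriorAlgebra.ι ℂ (Pi.single j 1 : E5) * ExteriorAlgebra.ι ℂ (Pi.single i 1 : E5)) :=
        eq_neg_of_add_eq_zero_left (ExteriorAlgebra.ι_add_mul_swap _ _)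
      rw [mono_cons, mono_cons, ← mul_assoc, h, neg_mul, mul_assoc, ← mono_cons, ih, mono_cons j,
        mul_smul_comm, neg_smul]

lemma mono_eq_sortSign (l : List (Fin 5)) : mono l = (sortSign l).1 • mono (sortSign l).2 := by
  induction l with
  | nil => simp [sortSign]
  | cons i l ih =>
    rw [mono_cons, ih, mul_smul_comm, ← mono_cons, mono_cons_eq_insertSign, smul_smul]
    rfl

lemma insertSign_pairwise (i : Fin 5) {l : List (Fin 5)} (hl : l.Pairwise (· < ·)) :
    (insertSign i l).2.Pairwise (· < ·) ∧ ∀ x ∈ (insertSign i l).2, x = i ∨ x ∈ l := by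
  induction l with
  | nil => simp [insertSign]
  | cons j l ih =>
    rw [List.pairwise_cons] at hl
    obtain ⟨ih1, ih2⟩ := ih hl.2
    rw [insertSign]
    split_ifs with h1 h2
    · refine ⟨?_, by simp⟩
      simp only [List.pairwise_cons, List.mem_cons, forall_eq_or_imp]
      exact ⟨⟨h1, fun x hx => h1.trans (hl.1 x hx)⟩, hl⟩
    · simp
    · refine ⟨?_, ?_⟩
      · rw [List.pairwise_cons]
        refine ⟨fun x hx => ?_, ih1⟩
        rcases ih2 x hx with rfl | hx
        · exact lt_of_le_of_ne (not_lt.1 h1) (Ne.symm h2)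
        · exact hl.1 x hx
      · intro x hx
        rcases List.mem_cons.1 hx with rfl | hx
        · simp
        · rcases ih2 x hx with rfl | hx
          · simp
          · simp [hx]

lemma sortSign_pairwise (l : List (Fin 5)) : (sortSign l).2.Pairwise (· < ·) := by
  induction l with
  | nil => simp [sortSign]
  | cons i l ih => exact (insertSign_pairwise i ih).1

lemma eq_of_pairwise_of_length {l : List (Fin 5)} (h : l.Pairwise (· < ·)) (h5 : l.length = 5) :
    l = [0, 1, 2, 3, 4] := by
  match l, h5 with
  | [a, b, c, d, e], _ =>
    simp only [List.pairwise_cons, List.mem_cons, List.not_mem_nil, Fin.lt_def] at h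
    have h1 := h.1 b (by simp)
    have h2 := h.2.1 c (by simp)
    have h3 := h.2.2.1 d (by simp)
    have h4 := h.2.2.2.1 e (by simp)
    simp only [List.cons.injEq, Fin.ext_iff, and_true]
    simp
    omega

lemma topCoeff_mono_of_length (l : List (Fin 5)) (h : l.length ≠ 5) : topCoeff (mono l) = 0 := by
  have h1 : mono l = ExteriorAlgebra.ιMulti ℂ l.length
      (fun i => (Pi.single (l.get i) 1 : E5)) := by
    rw [ExteriorAlgebra.ιMulti_apply, mono]
    congr 1
    exact List.ext_get (by simp) (by simp)
  rw [h1, topCoeff, ExteriorAlgebra.liftAlternating_apply_ιMulti]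
  simp [h]

lemma topCoeff_mono (l : List (Fin 5)) : topCoeff (mono l) = topSign l := by
  rw [mono_eq_sortSign, map_zsmul, topSign]
  split_ifs with h
  · rw [h]
    have h1 : mono [0, 1, 2, 3, 4] = ExteriorAlgebra.ιMulti ℂ 5 fun i => (Pi.single i 1 : E5) := by
      rw [ExteriorAlgebra.ιMulti_apply, mono]
      congr 1
    have h2 : topCoeff (mono [0, 1, 2, 3, 4]) = 1 := by
      have h3 : (fun i => (Pi.single i 1 : E5)) = (1 : Matrix (Fin 5) (Fin 5) ℂ) := by
        ext i j
        rw [Matrix.one_apply, Pi.single_apply]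
        simp [eq_comm]
      have h4 : (Matrix.detRowAlternating : E5 [⋀^Fin 5]→ₗ[ℂ] ℂ)
          (1 : Matrix (Fin 5) (Fin 5) ℂ) = 1 := by
        change Matrix.det (1 : Matrix (Fin 5) (Fin 5) ℂ) = 1
        simp
      rw [h1, topCoeff, ExteriorAlgebra.liftAlternating_apply_ιMulti, Pi.single_eq_same, h3, h4]
    rw [h2]
    simp
  · rw [topCoeff_mono_of_length _ fun h5 => h (eq_of_pairwise_of_length (sortSign_pairwise l) h5)]
    simp

/-- The coefficient of `e₁ ∧ ⋯ ∧ e₅` in the product of the monomial of `g` with the contraction of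
the monomial of `l` by the coordinate form of index `k`. -/
def contractSign (k : Fin 5) : List (Fin 5) → List (Fin 5) → ℤ
  | _, [] => 0
  | g, j :: l => (if k = j then topSign (g ++ l) else 0) - contractSign k (g ++ [j]) l

lemma topCoeff_mono_mul_contractLeft (k : Fin 5) (g l : List (Fin 5)) :
    topCoeff (mono g * CliffordAlgebra.contractLeft (LinearMap.proj k : Module.Dual ℂ E5)
      (mono l)) = contractSign k g l := by
  induction l generalizing g with
  | nil => simp [mono, contractSign]
  | cons j l ih =>
    have h : CliffordAlgebra.contractLeft (LinearMap.proj k : Module.Dual ℂ E5) (mono (j :: l)) =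
        (Pi.single j 1 : E5) k • mono l - ExteriorAlgebra.ι ℂ (Pi.single j 1 : E5) *
          CliffordAlgebra.contractLeft (LinearMap.proj k : Module.Dual ℂ E5) (mono l) := by
      rw [mono_cons]
      exact CliffordAlgebra.contractLeft_ι_mul _ _ _
    have h' : mono g * ExteriorAlgebra.ι ℂ (Pi.single j 1 : E5) = mono (g ++ [j]) := by
      rw [mono_append]
      simp [mono]
    rw [h, mul_sub, map_sub, ← mul_assoc, h', ih, mul_smul_comm, ← mono_append, map_smul,
      topCoeff_mono, contractSign, Pi.single_apply]
    split_ifs <;> simp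

lemma spinPairing_mono_ι_mul (k : Fin 5) (l m : List (Fin 5)) :
    spinPairing (mono l) (cliffordMul (0, Pi.single k 1) (mono m)) =
      topSign (l.reverse ++ k :: m) := by
  have h : cliffordMul (0, Pi.single k 1) (mono m) = mono (k :: m) := by
    simp [cliffordMul, mono_cons]
  rw [spinPairing, h, reverse_mono, ← mono_append, topCoeff_mono]

lemma spinPairing_mono_contractLeft (k : Fin 5) (l m : List (Fin 5)) :
    spinPairing (mono l) (cliffordMul (LinearMap.proj k, 0) (mono m)) =
      contractSign k l.reverse m := by
  have h : cliffordMul (LinearMap.proj k, 0) (mono m) =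
      CliffordAlgebra.contractLeft (LinearMap.proj k : Module.Dual ℂ E5) (mono m) := by
    simp [cliffordMul]
  rw [spinPairing, h, reverse_mono, topCoeff_mono_mul_contractLeft]

/-- The index lists of the monomials in the Cartan basis. -/
def cartanIndex : Fin 4 → Fin 4 → List (Fin 5) :=
  ![![[4, 2], [0, 1, 3, 4], [3, 1], [2, 0]], ![[4, 1], [0, 2, 3, 4], [2, 3], [0, 1]],
    ![[0, 1, 2, 3], [], [0, 1, 2, 4], [4, 3]], ![[0, 3], [1, 2], [4, 0], [1, 2, 3, 4]]]

lemma cartanBasis_eq (i p : Fin 4) : cartanBasis i p = mono (cartanIndex i p) := by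
  fin_cases i <;> fin_cases p <;> rfl

lemma spinPairing_spinorMap (T : Spinors →ₗ[ℂ] Spinors) (a x : Fin 4 → ℂ)
    (s : Fin 4 → Fin 4 → Fin 4 → Fin 4 → ℤ)
    (hs : ∀ i p j q, spinPairing (mono (cartanIndex i p)) (T (mono (cartanIndex j q))) =
      s i p j q) :
    spinPairing (spinorMap a x) (T (spinorMap a x)) =
      ∑ j, ∑ q, ∑ i, ∑ p, a i * x p * (a j * x q) * s i p j q := by
  simp only [spinPairing] at hs
  simp only [spinPairing, spinorMap, map_sum, map_smul, Finset.sum_mul, Finset.mul_sum,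
    smul_mul_assoc, mul_smul_comm, cartanBasis_eq, hs, smul_eq_mul]
  refine Finset.sum_congr rfl fun j _ => Finset.sum_congr rfl fun q _ =>
    Finset.sum_congr rfl fun i _ => Finset.sum_congr rfl fun p _ => ?_
  ring

/-- For each `k` and each monomial of the Cartan basis, the only monomial of the Cartan basis whose
pairing with the exterior product by `e_{k+1}` of the given one is non-zero (as the two indices of
its position), and the value of the pairing, which is zero if there is no such monomial. -/
def wedgePartner : Fin 5 → Fin 4 → Fin 4 → Fin 4 × Fin 4 × ℤ :=
  ![![![(0, 2, 1), (0, 0, 0), (0, 0, 1), (0, 0, 0)],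
      ![(1, 2, 1), (0, 0, 0), (1, 0, 1), (0, 0, 0)],
      ![(0, 0, 0), (3, 3, 1), (0, 0, 0), (3, 1, 1)],
      ![(0, 0, 0), (2, 3, 1), (0, 0, 0), (2, 1, 1)]],
    ![![(3, 0, 1), (0, 0, 0), (0, 0, 0), (2, 3, 1)],
      ![(0, 0, 0), (2, 1, -1), (3, 2, -1), (0, 0, 0)],
      ![(0, 0, 0), (1, 1, -1), (0, 0, 0), (0, 3, 1)],
      ![(0, 0, 1), (0, 0, 0), (1, 2, -1), (0, 0, 0)]],
    ![![(0, 0, 0), (2, 1, 1), (3, 2, -1), (0, 0, 0)],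
      ![(3, 0, -1), (0, 0, 0), (0, 0, 0), (2, 3, 1)],
      ![(0, 0, 0), (0, 1, 1), (0, 0, 0), (1, 3, 1)],
      ![(1, 0, -1), (0, 0, 0), (0, 2, -1), (0, 0, 0)]],
    ![![(1, 3, -1), (0, 0, 0), (0, 0, 0), (1, 0, -1)],
      ![(0, 3, -1), (0, 0, 0), (0, 0, 0), (0, 0, -1)],
      ![(0, 0, 0), (2, 2, -1), (2, 1, -1), (0, 0, 0)],
      ![(0, 0, 0), (3, 2, -1), (3, 1, -1), (0, 0, 0)]],
    ![![(0, 0, 0), (0, 0, 0), (0, 3, 1), (0, 2, 1)],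
      ![(0, 0, 0), (0, 0, 0), (1, 3, -1), (1, 2, -1)],
      ![(2, 1, 1), (2, 0, 1), (0, 0, 0), (0, 0, 0)],
      ![(3, 1, -1), (3, 0, -1), (0, 0, 0), (0, 0, 0)]]]

/-- The analogue of `wedgePartner` for the contraction by the `k`-th coordinate form. -/
def contractPartner : Fin 5 → Fin 4 → Fin 4 → Fin 4 × Fin 4 × ℤ :=
  ![![![(0, 0, 0), (0, 3, -1), (0, 0, 0), (0, 1, -1)],
      ![(0, 0, 0), (1, 3, -1), (0, 0, 0), (1, 1, -1)],
      ![(3, 2, -1), (0, 0, 0), (3, 0, -1), (0, 0, 0)],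
      ![(2, 2, -1), (0, 0, 0), (2, 0, -1), (0, 0, 0)]],
    ![![(0, 0, 0), (3, 1, 1), (2, 2, 1), (0, 0, 0)],
      ![(2, 0, -1), (0, 0, 0), (0, 0, 0), (3, 3, -1)],
      ![(1, 0, -1), (0, 0, 0), (0, 2, 1), (0, 0, 0)],
      ![(0, 0, 0), (0, 1, 1), (0, 0, 0), (1, 3, -1)]],
    ![![(2, 0, -1), (0, 0, 0), (0, 0, 0), (3, 3, 1)],
      ![(0, 0, 0), (3, 1, 1), (2, 2, -1), (0, 0, 0)],
      ![(0, 0, -1), (0, 0, 0), (1, 2, -1), (0, 0, 0)],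
      ![(0, 0, 0), (1, 1, 1), (0, 0, 0), (0, 3, 1)]],
    ![![(0, 0, 0), (1, 2, -1), (1, 1, -1), (0, 0, 0)],
      ![(0, 0, 0), (0, 2, -1), (0, 1, -1), (0, 0, 0)],
      ![(2, 3, -1), (0, 0, 0), (0, 0, 0), (2, 0, -1)],
      ![(3, 3, -1), (0, 0, 0), (0, 0, 0), (3, 0, -1)]],
    ![![(0, 1, 1), (0, 0, 1), (0, 0, 0), (0, 0, 0)],
      ![(1, 1, -1), (1, 0, -1), (0, 0, 0), (0, 0, 0)],
      ![(0, 0, 0), (0, 0, 0), (2, 3, -1), (2, 2, -1)],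
      ![(0, 0, 0), (0, 0, 0), (3, 3, 1), (3, 2, 1)]]]

lemma topSign_cartanIndex (k : Fin 5) (i p j q : Fin 4) :
    topSign ((cartanIndex i p).reverse ++ k :: cartanIndex j q) =
      if i = (wedgePartner k j q).1 ∧ p = (wedgePartner k j q).2.1
        then (wedgePartner k j q).2.2 else 0 := by
  revert k i p j q
  decide +kernel

lemma contractSign_cartanIndex (k : Fin 5) (i p j q : Fin 4) :
    contractSign k (cartanIndex i p).reverse (cartanIndex j q) =
      if i = (contractPartner k j q).1 ∧ p = (contractPartner k j q).2.1
        then (contractPartner k j q).2.2 else 0 := by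
  revert k i p j q
  decide +kernel

lemma spinPairing_spinorMap_of_partner (T : Spinors →ₗ[ℂ] Spinors) (a x : Fin 4 → ℂ)
    (P : Fin 4 → Fin 4 → Fin 4 × Fin 4 × ℤ)
    (hP : ∀ i p j q, spinPairing (mono (cartanIndex i p)) (T (mono (cartanIndex j q))) =
      ((if i = (P j q).1 ∧ p = (P j q).2.1 then (P j q).2.2 else 0 : ℤ) : ℂ)) :
    spinPairing (spinorMap a x) (T (spinorMap a x)) =
      ∑ j, ∑ q, a (P j q).1 * x (P j q).2.1 * (a j * x q) * (P j q).2.2 := by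
  rw [spinPairing_spinorMap T a x _ hP]
  refine Finset.sum_congr rfl fun j _ => Finset.sum_congr rfl fun q _ => ?_
  simp [ite_and, Finset.sum_ite_eq']

/-- The coordinates of `γ_a(x)` along `E`. -/
lemma gammaAt_snd (a x : Fin 4 → ℂ) : (gammaAt a x).2 =
    ![-2 * (a 0 ^ 2 + a 1 ^ 2) * (x 1 * x 3) - 4 * a 2 * a 3 * (x 0 * x 2),
      2 * a 0 * (a 2 * x 2 ^ 2 + a 3 * x 1 ^ 2) - 2 * a 1 * (a 2 * x 0 ^ 2 + a 3 * x 3 ^ 2),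
      2 * a 0 * (a 3 * x 3 ^ 2 - a 2 * x 0 ^ 2) + 2 * a 1 * (a 3 * x 1 ^ 2 - a 2 * x 2 ^ 2),
      -4 * a 0 * a 1 * (x 1 * x 2) - 2 * (a 2 ^ 2 + a 3 ^ 2) * (x 0 * x 3),
      2 * (a 0 ^ 2 - a 1 ^ 2) * (x 0 * x 1) - 2 * (a 2 ^ 2 - a 3 ^ 2) * (x 2 * x 3)] := by
  ext k
  simp only [gammaAt, gamma]
  rw [spinPairing_spinorMap_of_partner _ _ _ (contractPartner k) fun i p j q => by
    rw [spinPairing_mono_contractLeft, contractSign_cartanIndex]]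
  fin_cases k <;>
  · simp [Fin.sum_univ_four, contractPartner]
    ring

/-- The coordinates of `γ_a(x)` along `F`. -/
lemma gammaAt_fst (a x : Fin 4 → ℂ) : (gammaAt a x).1 = Fintype.linearCombination ℂ
    ![2 * (a 0 ^ 2 + a 1 ^ 2) * (x 0 * x 2) + 4 * a 2 * a 3 * (x 1 * x 3),
      2 * a 0 * (a 2 * x 3 ^ 2 + a 3 * x 0 ^ 2) - 2 * a 1 * (a 2 * x 1 ^ 2 + a 3 * x 2 ^ 2),
      2 * a 0 * (a 2 * x 1 ^ 2 - a 3 * x 2 ^ 2) + 2 * a 1 * (a 2 * x 3 ^ 2 - a 3 * x 0 ^ 2),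
      -4 * a 0 * a 1 * (x 0 * x 3) - 2 * (a 2 ^ 2 + a 3 ^ 2) * (x 1 * x 2),
      2 * (a 0 ^ 2 - a 1 ^ 2) * (x 2 * x 3) + 2 * (a 2 ^ 2 - a 3 ^ 2) * (x 0 * x 1)] := by
  simp only [gammaAt, gamma]
  congr 1
  ext k
  rw [spinPairing_spinorMap_of_partner _ _ _ (wedgePartner k) fun i p j q => by
    rw [spinPairing_mono_ι_mul, topSign_cartanIndex]]
  fin_cases k <;>
  · simp [Fin.sum_univ_four, wedgePartner]
    ring

/-! ### The discriminant of a quadratic complex -/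

/-- The determinant of three vectors of `ℂ³`. -/
def tripleProduct (p q r : Fin 3 → ℂ) : ℂ :=
  p 0 * (q 1 * r 2 - q 2 * r 1) - p 1 * (q 0 * r 2 - q 2 * r 0) + p 2 * (q 0 * r 1 - q 1 * r 0)

/-- The coefficients of the ternary quadratic form
`α(p² - p'²) + β(r² + r'²) + δ(s² + s'²) + 2l₁pp' + 2l₂rr'` in six linear forms. -/
def gramEntry (α β δ l₁ l₂ : ℂ) (p p' r r' s s' : Fin 3 → ℂ) (i j : Fin 3) : ℂ :=
  α * (p i * p j - p' i * p' j) + β * (r i * r j + r' i * r' j) + δ * (s i * s j + s' i * s' j)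
    + l₁ * (p i * p' j + p' i * p j) + l₂ * (r i * r' j + r' i * r j)

/-- The tensor product of the binary quadratic forms `αx² - αx'² + 2l₁xx'` and
`βy² + βy'² + 2l₂yy'`, at the tensor with coordinates `t, t', t₁, t₁'` (for `xy, xy', x'y, x'y'`). -/
def tensorForm (α β l₁ l₂ t t' t₁ t₁' : ℂ) : ℂ :=
  α * β * (t ^ 2 + t' ^ 2 - t₁ ^ 2 - t₁' ^ 2) + 2 * α * l₂ * (t * t' - t₁ * t₁')
    + 2 * l₁ * β * (t * t₁ + t' * t₁') + 2 * l₁ * l₂ * (t * t₁' + t' * t₁)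

/-- The Cauchy-Binet formula for the discriminant of the restriction of a quadratic form in six
variables to a three-dimensional space. -/
lemma det_gramEntry (α β δ l₁ l₂ : ℂ) (p p' r r' s s' : Fin 3 → ℂ) :
    Matrix.det (Matrix.of fun i j => gramEntry α β δ l₁ l₂ p p' r r' s s' i j) =
      (-α ^ 2 - l₁ ^ 2) * (β * (tripleProduct p p' r ^ 2 + tripleProduct p p' r' ^ 2)
          + 2 * l₂ * tripleProduct p p' r * tripleProduct p p' r'
          + δ * (tripleProduct p p' s ^ 2 + tripleProduct p p' s' ^ 2))
        + (β ^ 2 - l₂ ^ 2) * (α * (tripleProduct p r r' ^ 2 - tripleProduct p' r r' ^ 2)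
          + 2 * l₁ * tripleProduct p r r' * tripleProduct p' r r'
          + δ * (tripleProduct r r' s ^ 2 + tripleProduct r r' s' ^ 2))
        + δ ^ 2 * (α * (tripleProduct p s s' ^ 2 - tripleProduct p' s s' ^ 2)
          + 2 * l₁ * tripleProduct p s s' * tripleProduct p' s s'
          + β * (tripleProduct r s s' ^ 2 + tripleProduct r' s s' ^ 2)
          + 2 * l₂ * tripleProduct r s s' * tripleProduct r' s s')
        + δ * tensorForm α β l₁ l₂ (tripleProduct p r s) (tripleProduct p r' s)
          (tripleProduct p' r s) (tripleProduct p' r' s)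
        + δ * tensorForm α β l₁ l₂ (tripleProduct p r s') (tripleProduct p r' s')
          (tripleProduct p' r s') (tripleProduct p' r' s') := by
  rw [Matrix.det_fin_three]
  simp only [Matrix.of_apply, gramEntry, tripleProduct, tensorForm]
  ring

/-- The Plücker coordinate of index `i, j` of the line through `v` and `w`. -/
def pluckerCoord (i j : Fin 4) (v w : Fin 4 → ℂ) : ℂ := v i * w j - v j * w i

/-- The Plücker coordinate of index `i, j` on the lines of the plane spanned by `u₀, u₁, u₂`, in
the basis `u₁ ∧ u₂, u₂ ∧ u₀, u₀ ∧ u₁`. -/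
def lineColumn (u : Fin 3 → Fin 4 → ℂ) (i j : Fin 4) : Fin 3 → ℂ :=
  ![pluckerCoord i j (u 1) (u 2), pluckerCoord i j (u 2) (u 0), pluckerCoord i j (u 0) (u 1)]

lemma planeEquation_apply (u : Fin 3 → Fin 4 → ℂ) (k : Fin 4) : planeEquation u k =
    ![-(u 0 1 * pluckerCoord 2 3 (u 1) (u 2) - u 0 2 * pluckerCoord 1 3 (u 1) (u 2)
        + u 0 3 * pluckerCoord 1 2 (u 1) (u 2)),
      u 0 0 * pluckerCoord 2 3 (u 1) (u 2) - u 0 2 * pluckerCoord 0 3 (u 1) (u 2)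
        + u 0 3 * pluckerCoord 0 2 (u 1) (u 2),
      -(u 0 0 * pluckerCoord 1 3 (u 1) (u 2) - u 0 1 * pluckerCoord 0 3 (u 1) (u 2)
        + u 0 3 * pluckerCoord 0 1 (u 1) (u 2)),
      u 0 0 * pluckerCoord 1 2 (u 1) (u 2) - u 0 1 * pluckerCoord 0 2 (u 1) (u 2)
        + u 0 2 * pluckerCoord 0 1 (u 1) (u 2)] k := by
  fin_cases k <;>
  · simp [planeEquation, Matrix.det_succ_row_zero, Fin.sum_univ_succ, Fin.succAbove, pluckerCoord,
      Matrix.submatrix, Pi.single_apply]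
    ring

/-- The third compound of the Plücker coordinates of the lines in a plane consists of the products
of two coordinates of the plane. -/
lemma tripleProduct_lineColumn {u : Fin 3 → Fin 4 → ℂ} {ℓ : Fin 4 → Fin 4 → Fin 3 → ℂ}
    {h : Fin 4 → ℂ} (hℓ : ℓ = lineColumn u) (hh : h = planeEquation u) :
    tripleProduct (ℓ 0 1) (ℓ 2 3) (ℓ 0 2) = -(h 1 * h 3) ∧
    tripleProduct (ℓ 0 1) (ℓ 2 3) (ℓ 1 3) = -(h 0 * h 2) ∧
    tripleProduct (ℓ 0 1) (ℓ 2 3) (ℓ 0 3) = h 1 * h 2 ∧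
    tripleProduct (ℓ 0 1) (ℓ 2 3) (ℓ 1 2) = h 0 * h 3 ∧
    tripleProduct (ℓ 0 1) (ℓ 0 2) (ℓ 1 3) = -(h 2 * h 3) ∧
    tripleProduct (ℓ 0 1) (ℓ 0 2) (ℓ 0 3) = 0 ∧
    tripleProduct (ℓ 0 1) (ℓ 0 2) (ℓ 1 2) = h 3 ^ 2 ∧
    tripleProduct (ℓ 0 1) (ℓ 1 3) (ℓ 0 3) = -h 2 ^ 2 ∧
    tripleProduct (ℓ 0 1) (ℓ 1 3) (ℓ 1 2) = 0 ∧
    tripleProduct (ℓ 0 1) (ℓ 0 3) (ℓ 1 2) = -(h 2 * h 3) ∧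
    tripleProduct (ℓ 2 3) (ℓ 0 2) (ℓ 1 3) = -(h 0 * h 1) ∧
    tripleProduct (ℓ 2 3) (ℓ 0 2) (ℓ 0 3) = h 1 ^ 2 ∧
    tripleProduct (ℓ 2 3) (ℓ 0 2) (ℓ 1 2) = 0 ∧
    tripleProduct (ℓ 2 3) (ℓ 1 3) (ℓ 0 3) = 0 ∧
    tripleProduct (ℓ 2 3) (ℓ 1 3) (ℓ 1 2) = -h 0 ^ 2 ∧
    tripleProduct (ℓ 2 3) (ℓ 0 3) (ℓ 1 2) = h 0 * h 1 ∧
    tripleProduct (ℓ 0 2) (ℓ 1 3) (ℓ 0 3) = h 1 * h 2 ∧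
    tripleProduct (ℓ 0 2) (ℓ 1 3) (ℓ 1 2) = -(h 0 * h 3) ∧
    tripleProduct (ℓ 0 2) (ℓ 0 3) (ℓ 1 2) = h 1 * h 3 ∧
    tripleProduct (ℓ 1 3) (ℓ 0 3) (ℓ 1 2) = -(h 0 * h 2) := by
  subst hℓ hh
  refine ⟨?_, ?_, ?_, ?_, ?_, ?_, ?_, ?_, ?_, ?_, ?_, ?_, ?_, ?_, ?_, ?_, ?_, ?_, ?_, ?_⟩ <;>
  · simp [planeEquation_apply, tripleProduct, lineColumn, pluckerCoord]
    ring

lemma det_gramEntry_lineColumn (α β δ l₁ l₂ : ℂ) (u : Fin 3 → Fin 4 → ℂ) :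
    Matrix.det (Matrix.of fun i j => gramEntry α β δ l₁ l₂ (lineColumn u 0 1) (lineColumn u 2 3)
      (lineColumn u 0 2) (lineColumn u 1 3) (lineColumn u 0 3) (lineColumn u 1 2) i j) =
      α * β * δ * (planeEquation u 2 ^ 4 + planeEquation u 3 ^ 4 - planeEquation u 0 ^ 4
          - planeEquation u 1 ^ 4)
        + α * (β ^ 2 + δ ^ 2 - l₂ ^ 2) * (planeEquation u 2 ^ 2 * planeEquation u 3 ^ 2
          - planeEquation u 0 ^ 2 * planeEquation u 1 ^ 2)
        + β * (δ ^ 2 - α ^ 2 - l₁ ^ 2) * (planeEquation u 1 ^ 2 * planeEquation u 3 ^ 2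
          + planeEquation u 0 ^ 2 * planeEquation u 2 ^ 2)
        + δ * (β ^ 2 - α ^ 2 - (l₁ + l₂) ^ 2) * (planeEquation u 1 ^ 2 * planeEquation u 2 ^ 2
          + planeEquation u 0 ^ 2 * planeEquation u 3 ^ 2)
        + 2 * (β ^ 2 * l₁ - α ^ 2 * l₂ - δ ^ 2 * (l₁ + l₂) - l₁ * l₂ * (l₁ + l₂)) *
          (planeEquation u 0 * planeEquation u 1 * planeEquation u 2 * planeEquation u 3) := by
  obtain ⟨h1, h2, h3, h4, h5, h6, h7, h8, h9, h10, h11, h12, h13, h14, h15, h16, h17, h18, h19,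
    h20⟩ := tripleProduct_lineColumn (u := u) rfl rfl
  rw [det_gramEntry, h1, h2, h3, h4, h5, h6, h7, h8, h9, h10, h11, h12, h13, h14, h15, h16, h17,
    h18, h19, h20]
  simp only [tensorForm]
  ring

/-- The discriminant of a ternary quadratic form given by a symmetric matrix. -/
lemma discr'_eq_det (Q : QuadraticForm ℂ (Fin 3 → ℂ)) (M : Matrix (Fin 3) (Fin 3) ℂ)
    (hM : ∀ i j, M i j = M j i) (h : ∀ c, Q c = ∑ i, ∑ j, M i j * (c i * c j)) :
    Q.discr' = M.det := by
  rw [QuadraticForm.discr']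
  congr 1
  ext i j
  rw [QuadraticForm.toMatrix', LinearMap.toMatrix₂'_apply, QuadraticMap.associated_apply, h, h, h]
  simp [Fin.sum_univ_three, Pi.single_apply]
  have h10 := hM 1 0
  have h20 := hM 2 0
  have h21 := hM 2 1
  fin_cases i <;> fin_cases j <;> simp [h10, h20, h21] <;> ring

/-! ### The Kummer quartic of a point of the Cartan subspace -/

/-- The Heisenberg-invariant quartics `G, B, D, b, c` on the Cartan subspace, for a square root `I`
of `-1`. The numbers `-G, G, c - B, c + B, b + D, b - D` are proportional to the Klein coefficients
of the quadratic complex, up to a common translation. -/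
def heisenbergQuartics {R : Type*} [CommRing R] (I : R) (a : Fin 4 → R) : Fin 5 → R :=
  ![2 * I * (a 0 ^ 2 - a 1 ^ 2) * (a 3 ^ 2 - a 2 ^ 2), 4 * (a 0 ^ 2 + a 1 ^ 2) * (a 2 * a 3),
    -4 * (a 0 * a 1) * (a 2 ^ 2 + a 3 ^ 2), (a 0 ^ 2 + a 1 ^ 2) ^ 2 + 4 * (a 2 * a 3) ^ 2,
    (a 2 ^ 2 + a 3 ^ 2) ^ 2 + 4 * (a 0 * a 1) ^ 2]

/-- The coefficients of Hudson's form of the Kummer quartic, up to a common factor, as cubic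
polynomials in the Klein coefficients `-G, G, c - B, c + B, b + D, b - D`. -/
def hudsonCoefficients {R : Type*} [CommRing R] (p : Fin 5 → R) : Fin 5 → R :=
  ![-p 0 * ((p 3 - p 4) ^ 2 - p 1 ^ 2 - p 2 ^ 2), p 1 * (p 3 ^ 2 - p 0 ^ 2 - p 2 ^ 2),
    p 2 * (p 4 ^ 2 - p 0 ^ 2 - p 1 ^ 2),
    -(p 0 ^ 2 * (p 3 - p 4) - p 1 ^ 2 * p 3 + p 2 ^ 2 * p 4 - p 3 * p 4 * (p 3 - p 4)),
    p 0 * p 1 * p 2]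

/-- The polynomials `A, B, C, D, E` of degree twelve on the Cartan subspace. -/
noncomputable def kummerCoefficients (i : Fin 5) : MvPolynomial (Fin 4) ℂ :=
  MvPolynomial.C (8 * Complex.I) *
    hudsonCoefficients (heisenbergQuartics (MvPolynomial.C Complex.I) MvPolynomial.X) i

lemma eval_kummerCoefficients (a : Fin 4 → ℂ) (i : Fin 5) :
    MvPolynomial.eval a (kummerCoefficients i) =
      8 * Complex.I * hudsonCoefficients (heisenbergQuartics Complex.I a) i := by
  fin_cases i <;> simp [kummerCoefficients, hudsonCoefficients, heisenbergQuartics]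

/-- The Plücker coordinates as linear forms on `Λ²ℂ⁴`. -/
noncomputable def pluckerForm (i j : Fin 4) : ⋀[ℂ]^2 (Fin 4 → ℂ) →ₗ[ℂ] ℂ :=
  exteriorPower.alternatingMapLinearEquiv
    ((Matrix.detRowAlternating : (Fin 2 → ℂ) [⋀^Fin 2]→ₗ[ℂ] ℂ).compLinearMap
      (LinearMap.pi ![LinearMap.proj i, LinearMap.proj j]))

lemma pluckerForm_ιMulti (i j : Fin 4) (v w : Fin 4 → ℂ) :
    pluckerForm i j (exteriorPower.ιMulti ℂ 2 ![v, w]) = pluckerCoord i j v w := by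
  rw [pluckerForm, exteriorPower.alternatingMapLinearEquiv_apply_ιMulti,
    AlternatingMap.compLinearMap_apply]
  refine (Matrix.det_fin_two _).trans ?_
  simp [pluckerCoord]

/-- The coefficients of the quadratic complex of a point of the Cartan subspace, in the notation of
`gramEntry`. -/
def complexCoefficients (a : Fin 4 → ℂ) : Fin 5 → ℂ :=
  ![4 * (a 0 ^ 2 - a 1 ^ 2) * (a 3 ^ 2 - a 2 ^ 2), 8 * (a 0 ^ 2 + a 1 ^ 2) * (a 2 * a 3),
    -8 * (a 0 * a 1) * (a 2 ^ 2 + a 3 ^ 2),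
    -2 * ((a 0 ^ 2 + a 1 ^ 2) ^ 2 + 4 * (a 2 * a 3) ^ 2),
    2 * ((a 0 ^ 2 - a 1 ^ 2) ^ 2 - (a 3 ^ 2 - a 2 ^ 2) ^ 2)]

/-- The quadratic complex of a point of the Cartan subspace. -/
noncomputable def quadraticComplex (a : Fin 4 → ℂ) : QuadraticForm ℂ (⋀[ℂ]^2 (Fin 4 → ℂ)) :=
  complexCoefficients a 0 • (QuadraticMap.linMulLin (pluckerForm 0 1) (pluckerForm 0 1) -
      QuadraticMap.linMulLin (pluckerForm 2 3) (pluckerForm 2 3)) +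
    complexCoefficients a 1 • (QuadraticMap.linMulLin (pluckerForm 0 2) (pluckerForm 0 2) +
      QuadraticMap.linMulLin (pluckerForm 1 3) (pluckerForm 1 3)) +
    complexCoefficients a 2 • (QuadraticMap.linMulLin (pluckerForm 0 3) (pluckerForm 0 3) +
      QuadraticMap.linMulLin (pluckerForm 1 2) (pluckerForm 1 2)) +
    (2 * complexCoefficients a 3) • QuadraticMap.linMulLin (pluckerForm 0 1) (pluckerForm 2 3) +
    (2 * complexCoefficients a 4) • QuadraticMap.linMulLin (pluckerForm 0 2) (pluckerForm 1 3)

lemma isQuadraticComplex_quadraticComplex (a : Fin 4 → ℂ) :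
    IsQuadraticComplex a (quadraticComplex a) := by
  intro u v
  rw [LinearMap.dualProd_apply_apply, gammaAt_fst, gammaAt_fst, gammaAt_snd, gammaAt_snd]
  simp only [quadraticComplex, _root_.add_apply, _root_.sub_apply,
    _root_.smul_apply, QuadraticMap.linMulLin_apply, pluckerForm_ιMulti, smul_eq_mul]
  simp [pluckerCoord, complexCoefficients, Fintype.linearCombination_apply, Fin.sum_univ_succ]
  ring

/-- The lines in a plane form a plane in `ℙ(Λ²ℂ⁴)`, so a quadratic complex is determined on it. -/
lemma conic_eq_conic {a : Fin 4 → ℂ} {Θ Θ' : QuadraticForm ℂ (⋀[ℂ]^2 (Fin 4 → ℂ))}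
    (h : IsQuadraticComplex a Θ) (h' : IsQuadraticComplex a Θ') (u : Fin 3 → Fin 4 → ℂ) :
    conic Θ u = conic Θ' u := by
  have hdec (v w : Fin 4 → ℂ) : Θ (exteriorPower.ιMulti ℂ 2 ![v, w]) =
      Θ' (exteriorPower.ιMulti ℂ 2 ![v, w]) := by rw [h, h']
  ext c
  have key : ∃ v w : Fin 4 → ℂ, Fintype.linearCombination ℂ
      ![exteriorPower.ιMulti ℂ 2 ![u 1, u 2], exteriorPower.ιMulti ℂ 2 ![u 2, u 0],
        exteriorPower.ιMulti ℂ 2 ![u 0, u 1]] c = exteriorPower.ιMulti ℂ 2 ![v, w] := by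
    have hmul (v w : Fin 4 → ℂ) : ((exteriorPower.ιMulti ℂ 2 ![v, w] :
        ⋀[ℂ]^2 (Fin 4 → ℂ)) : ExteriorAlgebra ℂ (Fin 4 → ℂ)) =
        ExteriorAlgebra.ι ℂ v * ExteriorAlgebra.ι ℂ w := by
      simp [ExteriorAlgebra.ιMulti_apply]
    have hsw (v w : Fin 4 → ℂ) : ExteriorAlgebra.ι ℂ v * ExteriorAlgebra.ι ℂ w =
        -(ExteriorAlgebra.ι ℂ w * ExteriorAlgebra.ι ℂ v) :=
      eq_neg_of_add_eq_zero_left (ExteriorAlgebra.ι_add_mul_swap _ _)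
    by_cases h0 : c 0 = 0
    · refine ⟨u 0, c 2 • u 1 - c 1 • u 2, Subtype.ext ?_⟩
      rw [hmul]
      simp [Fintype.linearCombination_apply, Fin.sum_univ_three, h0, hsw (u 2) (u 0), mul_sub,
        ExteriorAlgebra.ιMulti_apply]
      abel
    · refine ⟨u 1 - (c 1 / c 0) • u 0, c 0 • u 2 - c 2 • u 0, Subtype.ext ?_⟩
      rw [hmul]
      simp [Fintype.linearCombination_apply, Fin.sum_univ_three, hsw (u 2) (u 0), hsw (u 0) (u 1),
        mul_sub, sub_mul, ExteriorAlgebra.ιMulti_apply]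
      rw [smul_sub, smul_smul, mul_div_cancel₀ _ h0]
      abel
  obtain ⟨v, w, hvw⟩ := key
  simp only [conic, QuadraticMap.comp_apply, hvw, hdec]

lemma discr'_conic_quadraticComplex (a : Fin 4 → ℂ) (u : Fin 3 → Fin 4 → ℂ) :
    (conic (quadraticComplex a) u).discr' = Matrix.det (Matrix.of fun i j =>
      gramEntry (complexCoefficients a 0) (complexCoefficients a 1) (complexCoefficients a 2)
        (complexCoefficients a 3) (complexCoefficients a 4) (lineColumn u 0 1) (lineColumn u 2 3)
        (lineColumn u 0 2) (lineColumn u 1 3) (lineColumn u 0 3) (lineColumn u 1 2) i j) := by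
  refine discr'_eq_det _ _ (fun i j => ?_) fun x => ?_
  · simp only [Matrix.of_apply, gramEntry]
    ring
  · simp only [conic, quadraticComplex, QuadraticMap.comp_apply, _root_.add_apply,
      _root_.sub_apply, _root_.smul_apply, QuadraticMap.linMulLin_apply, smul_eq_mul,
      Fintype.linearCombination_apply, Fin.sum_univ_three, map_add, map_smul, Matrix.cons_val_zero,
      Matrix.cons_val_one, Matrix.cons_val, pluckerForm_ιMulti, Matrix.of_apply, gramEntry,
      lineColumn]
    ring

lemma zeta8_sq : zeta8 ^ 2 = Complex.I := by
  rw [zeta8, ← Complex.exp_nat_mul]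
  convert Complex.exp_pi_div_two_mul_I using 2
  push_cast
  ring

/-- The quartic with the coefficients `kummerCoefficients` is the Kummer quartic. -/
lemma isKummerEquation (a : Fin 4 → ℂ) : IsKummerEquation a fun h =>
    hudsonQuartic (fun i => MvPolynomial.eval a (kummerCoefficients i))
      (h 0) (h 1) (zeta8 * h 2) (zeta8 * h 3) := by
  refine ⟨⟨_, isQuadraticComplex_quadraticComplex a⟩, fun Θ hΘ u => ?_⟩
  rw [conic_eq_conic hΘ (isQuadraticComplex_quadraticComplex a), discr'_conic_quadraticComplex,
    det_gramEntry_lineColumn]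
  have h2 := zeta8_sq
  have h4 : zeta8 ^ 4 = -1 := by
    rw [show 4 = 2 * 2 from rfl, pow_mul, h2, Complex.I_sq]
  have hI := Complex.I_sq
  beta_reduce
  generalize planeEquation u 0 = x, planeEquation u 1 = y, planeEquation u 2 = z,
    planeEquation u 3 = t
  have hq (c : Fin 5 → ℂ) : hudsonQuartic c x y (zeta8 * z) (zeta8 * t) =
      c 0 * (x ^ 2 * y ^ 2 - z ^ 2 * t ^ 2) + Complex.I * c 1 * (x ^ 2 * z ^ 2 + y ^ 2 * t ^ 2)
        + Complex.I * c 2 * (x ^ 2 * t ^ 2 + y ^ 2 * z ^ 2) + 2 * Complex.I * c 3 * (x * y * z * t)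
        + c 4 * (x ^ 4 + y ^ 4 - z ^ 4 - t ^ 4) := by
    unfold hudsonQuartic
    linear_combination (c 1 * (x ^ 2 * z ^ 2 + y ^ 2 * t ^ 2) + c 2 * (x ^ 2 * t ^ 2 + y ^ 2 * z ^ 2)
      + 2 * c 3 * (x * y * z * t)) * h2 + (c 0 * (z ^ 2 * t ^ 2) + c 4 * (z ^ 4 + t ^ 4)) * h4
  rw [hq]
  obtain ⟨g, B, D, b, c, hp, hc⟩ : ∃ g B D b c : ℂ,
      heisenbergQuartics Complex.I a = ![2 * Complex.I * g, B, D, b, c] ∧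
      complexCoefficients a = ![4 * g, 2 * B, 2 * D, -2 * b, 2 * (b - c)] := by
    refine ⟨(a 0 ^ 2 - a 1 ^ 2) * (a 3 ^ 2 - a 2 ^ 2),
      4 * (a 0 ^ 2 + a 1 ^ 2) * (a 2 * a 3), -4 * (a 0 * a 1) * (a 2 ^ 2 + a 3 ^ 2),
      (a 0 ^ 2 + a 1 ^ 2) ^ 2 + 4 * (a 2 * a 3) ^ 2,
      (a 2 ^ 2 + a 3 ^ 2) ^ 2 + 4 * (a 0 * a 1) ^ 2, ?_, ?_⟩
    · simp only [heisenbergQuartics, mul_assoc]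
    · simp only [complexCoefficients]
      ext i
      fin_cases i <;> simp <;> ring
  have e0 : 8 * Complex.I * (-(2 * Complex.I * g) * ((b - c) ^ 2 - B ^ 2 - D ^ 2)) =
      16 * g * ((b - c) ^ 2 - B ^ 2 - D ^ 2) := by
    linear_combination -16 * g * ((b - c) ^ 2 - B ^ 2 - D ^ 2) * hI
  have e1 : Complex.I * (8 * Complex.I * (B * (b ^ 2 - (2 * Complex.I * g) ^ 2 - D ^ 2))) =
      -8 * B * (b ^ 2 + 4 * g ^ 2 - D ^ 2) := by
    linear_combination 8 * B * (b ^ 2 - D ^ 2 - 4 * g ^ 2 * (Complex.I ^ 2 - 1)) * hI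
  have e2 : Complex.I * (8 * Complex.I * (D * (c ^ 2 - (2 * Complex.I * g) ^ 2 - B ^ 2))) =
      -8 * D * (c ^ 2 + 4 * g ^ 2 - B ^ 2) := by
    linear_combination 8 * D * (c ^ 2 - B ^ 2 - 4 * g ^ 2 * (Complex.I ^ 2 - 1)) * hI
  have e3 : Complex.I * (8 * Complex.I * -((2 * Complex.I * g) ^ 2 * (b - c) - B ^ 2 * b
      + D ^ 2 * c - b * c * (b - c))) =
      8 * (-4 * g ^ 2 * (b - c) - B ^ 2 * b + D ^ 2 * c - b * c * (b - c)) := by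
    linear_combination (-32 * g ^ 2 * (b - c) * (Complex.I ^ 2 - 1)
      + 8 * (B ^ 2 * b - D ^ 2 * c + b * c * (b - c))) * hI
  have e4 : 8 * Complex.I * (2 * Complex.I * g * B * D) = -16 * g * B * D := by
    linear_combination 16 * g * B * D * hI
  simp only [eval_kummerCoefficients, hudsonCoefficients, hp, hc, Matrix.cons_val_zero,
    Matrix.cons_val_one, Matrix.cons_val]
  linear_combination (x ^ 2 * y ^ 2 - z ^ 2 * t ^ 2) * e0
    + (x ^ 2 * z ^ 2 + y ^ 2 * t ^ 2) * e1 + (x ^ 2 * t ^ 2 + y ^ 2 * z ^ 2) * e2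
    + 2 * (x * y * z * t) * e3 + (x ^ 4 + y ^ 4 - z ^ 4 - t ^ 4) * e4

/-! ### The polynomials `A, B, C, D, E` -/

lemma heisenbergQuartics_isHomogeneous (i : Fin 5) :
    (heisenbergQuartics (MvPolynomial.C Complex.I) MvPolynomial.X i :
      MvPolynomial (Fin 4) ℂ).IsHomogeneous 4 := by
  have hn (n : ℕ) [n.AtLeastTwo] :
      (OfNat.ofNat n : MvPolynomial (Fin 4) ℂ).IsHomogeneous 0 :=
    MvPolynomial.isHomogeneous_C _ (OfNat.ofNat n : ℂ)
  have hX (j : Fin 4) := MvPolynomial.isHomogeneous_X ℂ j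
  have h2 (j : Fin 4) := (hX j).pow 2
  fin_cases i
  · exact (((hn 2).mul (MvPolynomial.isHomogeneous_C _ Complex.I)).mul
      ((h2 0).sub (h2 1))).mul ((h2 3).sub (h2 2))
  · exact ((hn 4).mul ((h2 0).add (h2 1))).mul ((hX 2).mul (hX 3))
  · exact ((hn 4).neg.mul ((hX 0).mul (hX 1))).mul ((h2 2).add (h2 3))
  · exact (((h2 0).add (h2 1)).pow 2).add ((hn 4).mul (((hX 2).mul (hX 3)).pow 2))
  · exact (((h2 2).add (h2 3)).pow 2).add ((hn 4).mul (((hX 0).mul (hX 1)).pow 2))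

lemma kummerCoefficients_isHomogeneous (i : Fin 5) : (kummerCoefficients i).IsHomogeneous 12 := by
  have h := heisenbergQuartics_isHomogeneous
  have h2 (j : Fin 5) := (h j).pow 2
  have h34 := (h 3).sub (h 4)
  refine (zero_add 12) ▸ (MvPolynomial.isHomogeneous_C _ (8 * Complex.I)).mul ?_
  fin_cases i
  · exact (h 0).neg.mul (((h34.pow 2).sub (h2 1)).sub (h2 2))
  · exact (h 1).mul (((h2 3).sub (h2 0)).sub (h2 2))
  · exact (h 2).mul (((h2 4).sub (h2 0)).sub (h2 1))
  · exact (((((h2 0).mul h34).sub ((h2 1).mul (h 3))).add ((h2 2).mul (h 4))).sub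
      (((h 3).mul (h 4)).mul h34)).neg
  · exact ((h 0).mul (h 1)).mul (h 2)

lemma linearIndependent_kummerCoefficients : LinearIndependent ℂ kummerCoefficients := by
  rw [Fintype.linearIndependent_iff]
  intro r hr
  have h (a : Fin 4 → ℂ) :
      ∑ i, r i * hudsonCoefficients (heisenbergQuartics Complex.I a) i = 0 := by
    have := congrArg (MvPolynomial.eval a) hr
    simp only [map_sum, MvPolynomial.smul_eval, eval_kummerCoefficients, map_zero] at this
    refine (mul_eq_zero.1 ?_).resolve_left
      (mul_ne_zero (by norm_num : (8 : ℂ) ≠ 0) Complex.I_ne_zero)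
    rw [← this, Finset.mul_sum]
    exact Finset.sum_congr rfl fun i _ => by ring
  have h1 := h ![1, 0, 2, 0]
  have h2 := h ![1, 0, 0, 2]
  have h3 := h ![1, 0, 1, 1]
  have h4 := h ![1, 1, 1, 0]
  have h5 := h ![1, 2, 1, 3]
  simp [Fin.sum_univ_five, hudsonCoefficients, heisenbergQuartics] at h1 h2 h3 h4 h5
  norm_num [mul_pow] at h1 h2 h3 h4 h5
  have r3 : r 3 = 0 := by linear_combination (-1 / 2400) * (h1 + h2)
  have r0 : r 0 = 0 := by
    have : r 0 * Complex.I = 0 := by linear_combination (1 / 3600) * (h1 - h2)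
    exact (mul_eq_zero.1 this).resolve_right Complex.I_ne_zero
  have r1 : r 1 = 0 := by linear_combination h3 / 100 - r3
  have r2 : r 2 = 0 := by linear_combination -h4 / 100 - r3
  have r4 : r 4 = 0 := by
    have : r 4 * Complex.I = 0 := by
      rw [r0, r1, r2, r3] at h5
      linear_combination h5 / 230400
    exact (mul_eq_zero.1 this).resolve_right Complex.I_ne_zero
  intro i
  fin_cases i <;> assumption

/-- The polynomials `A, B, C, D, E` satisfy the equation of the cubic threefold. -/
lemma eval_hudsonCubic_hudsonCoefficients (p : Fin 5 → ℂ) :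
    MvPolynomial.eval (hudsonCoefficients p) hudsonCubic = 0 := by
  rw [eval_hudsonCubic]
  simp only [hudsonCoefficients, Matrix.cons_val_zero, Matrix.cons_val_one, Matrix.cons_val]
  ring

/-! ### From the cubic threefold to the Klein coefficients -/

/-- A parametrization of the cubic threefold. The parameters `g, h, c, s` stand for the six points
`-g, g, c - h, c + h, s, ∞` of `ℙ¹`, up to a common scaling of the first five. -/
def cubicParametrization {R : Type*} [CommRing R] (x : Fin 4 → R) : Fin 5 → R :=
  ![2 * x 0 * (x 2 - x 3), 2 * x 3 * x 1, x 0 ^ 2 + x 1 ^ 2 - x 2 ^ 2,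
    x 1 ^ 2 - x 0 ^ 2 + 2 * x 3 * x 2 - x 2 ^ 2, -x 0 * x 1]

/-- The quadratic form `AB - 2E(C - D)`, one of the two that occur in `cubicSection`. -/
def sectionN {R : Type*} [CommRing R] (y : Fin 5 → R) : R := y 0 * y 1 - 2 * y 4 * (y 2 - y 3)

/-- The quadratic form `4E² - B²`, one of the two that occur in `cubicSection`. -/
def sectionM {R : Type*} [CommRing R] (y : Fin 5 → R) : R := 4 * y 4 ^ 2 - y 1 ^ 2

/-- A rational map from the cubic threefold that inverts `cubicParametrization`, up to scaling. -/
def cubicSection {R : Type*} [CommRing R] (y : Fin 5 → R) : Fin 4 → R :=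
  ![2 * y 4 * sectionN y, 2 * y 4 * sectionM y, -(y 0 * sectionM y + y 1 * sectionN y),
    -(y 1 * sectionN y)]

/-- The form whose non-vanishing makes `cubicSection` a section of `cubicParametrization`. -/
def sectionFactor {R : Type*} [CommRing R] (y : Fin 5 → R) : R :=
  -4 * y 4 * sectionN y * sectionM y

/-- The differences between the five finite points `-g, g, c - h, c + h, s` and a point `t`. -/
def branchDifferences {R : Type*} [CommRing R] (x : Fin 4 → R) (t : R) : Fin 5 → R :=
  ![-x 0 - t, x 0 - t, x 2 - x 1 - t, x 2 + x 1 - t, x 3 - t]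

/-- Twice the numbers `G, B, D, b, c` of six Klein coefficients, five of which are the products of
four of the five quantities `u`, while the last one is zero. -/
def cofactorCoefficients {R : Type*} [CommRing R] (u : Fin 5 → R) : Fin 5 → R :=
  ![u 0 * u 2 * u 3 * u 4 - u 1 * u 2 * u 3 * u 4, u 0 * u 1 * u 2 * u 4 - u 0 * u 1 * u 3 * u 4,
    u 0 * u 1 * u 2 * u 3,
    u 0 * u 1 * u 2 * u 3 - u 1 * u 2 * u 3 * u 4 - u 0 * u 2 * u 3 * u 4,
    u 0 * u 1 * u 3 * u 4 + u 0 * u 1 * u 2 * u 4 - u 1 * u 2 * u 3 * u 4 - u 0 * u 2 * u 3 * u 4]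

/-- The Klein coefficients with branch points `-g, g, c - h, c + h, s, ∞` after `t` is moved to
infinity. -/
def kleinCoefficients {R : Type*} [CommRing R] (x : Fin 4 → R) (t : R) : Fin 5 → R :=
  cofactorCoefficients (branchDifferences x t)

section
variable {R S : Type*} [CommRing R] [CommRing S] (φ : R →+* S)

lemma map_cubicSection (y : Fin 5 → R) (i : Fin 4) :
    φ (cubicSection y i) = cubicSection (φ ∘ y) i := by
  fin_cases i <;> simp [cubicSection, sectionM, sectionN, map_ofNat]

lemma map_sectionFactor (y : Fin 5 → R) : φ (sectionFactor y) = sectionFactor (φ ∘ y) := by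
  simp [sectionFactor, sectionM, sectionN, map_ofNat]

lemma map_branchDifferences (x : Fin 4 → R) (t : R) (i : Fin 5) :
    φ (branchDifferences x t i) = branchDifferences (φ ∘ x) (φ t) i := by
  fin_cases i <;> simp [branchDifferences]

lemma map_kleinCoefficients (x : Fin 4 → R) (t : R) (i : Fin 5) :
    φ (kleinCoefficients x t i) = kleinCoefficients (φ ∘ x) (φ t) i := by
  simp only [kleinCoefficients, cofactorCoefficients]
  fin_cases i <;> simp [map_branchDifferences]

end

lemma cubicSection_smul (c : ℂ) (y : Fin 5 → ℂ) :
    cubicSection (c • y) = c ^ 3 • cubicSection y := by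
  ext i
  fin_cases i <;> simp [cubicSection, sectionM, sectionN] <;> ring

lemma sectionFactor_smul (c : ℂ) (y : Fin 5 → ℂ) :
    sectionFactor (c • y) = c ^ 5 * sectionFactor y := by
  simp [sectionFactor, sectionM, sectionN]
  ring

lemma kleinCoefficients_smul (c : ℂ) (x : Fin 4 → ℂ) (t : ℂ) :
    kleinCoefficients (c • x) (c * t) = c ^ 4 • kleinCoefficients x t := by
  ext i
  fin_cases i <;> simp [kleinCoefficients, cofactorCoefficients, branchDifferences] <;> ring

lemma hudsonCoefficients_smul (c : ℂ) (p : Fin 5 → ℂ) :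
    hudsonCoefficients (c • p) = c ^ 3 • hudsonCoefficients p := by
  ext i
  fin_cases i <;> simp [hudsonCoefficients] <;> ring

lemma cubicParametrization_cubicSection {y : Fin 5 → ℂ}
    (hy : MvPolynomial.eval y hudsonCubic = 0) :
    cubicParametrization (cubicSection y) = sectionFactor y • y := by
  rw [eval_hudsonCubic] at hy
  ext i
  fin_cases i <;>
    simp [cubicParametrization, cubicSection, sectionFactor, sectionM, sectionN]
  · ring
  · ring
  · linear_combination 4 * y 4 * (4 * y 4 ^ 2 - y 1 ^ 2) * hy
  · linear_combination 4 * y 4 * (4 * y 4 ^ 2 - y 1 ^ 2) * hy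
  · ring

lemma hudsonCoefficients_kleinCoefficients (x : Fin 4 → ℂ) (t : ℂ) :
    hudsonCoefficients (kleinCoefficients x t) =
      (-4 * (∏ i, branchDifferences x t i) ^ 2) • cubicParametrization x := by
  have key (u : Fin 5 → ℂ) : hudsonCoefficients (cofactorCoefficients u) =
      (-4 * (∏ i, u i) ^ 2) • cubicParametrization ![(u 1 - u 0) / 2, (u 3 - u 2) / 2,
        (u 2 + u 3 - u 0 - u 1) / 2, u 4 - (u 0 + u 1) / 2] := by
    ext i
    fin_cases i <;>
      simp [hudsonCoefficients, cofactorCoefficients, cubicParametrization, Fin.prod_univ_succ] <;>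
      ring
  rw [kleinCoefficients, key]
  congr 2
  ext i
  fin_cases i <;> simp [branchDifferences] <;> ring

lemma sectionM_hudsonCoefficients (p : Fin 5 → ℂ) : sectionM (hudsonCoefficients p) =
    p 1 ^ 2 * (-(p 0 - p 3 + p 2) * (-p 0 - p 3 + p 2) * ((p 3 + p 2) ^ 2 - p 0 ^ 2)) := by
  simp [sectionM, hudsonCoefficients]
  ring

lemma sectionN_hudsonCoefficients (p : Fin 5 → ℂ) : sectionN (hudsonCoefficients p) =
    -(p 0 * p 1) * ((p 3 + p 2) ^ 2 - p 0 ^ 2) *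
      ((p 4 - p 1 - p 3 + p 2) * (p 4 + p 1 - p 3 + p 2)) := by
  simp [sectionN, hudsonCoefficients]
  ring

/-- If `u` is proportional to the inverses of five Klein coefficients `k`, the sixth one being zero,
then the products of four of the `u` are proportional to `k`. -/
lemma smul_cofactorCoefficients {k u : Fin 5 → ℂ} {α : ℂ} (h : ∀ i, u i * k i = α) :
    (k 0 * k 1 * k 2 * k 3 * k 4) • cofactorCoefficients u = α ^ 4 •
      ![k 1 - k 0, k 3 - k 2, k 4, k 4 - k 0 - k 1, k 3 + k 2 - k 0 - k 1] := by
  have v0 : k 0 * k 1 * k 2 * k 3 * k 4 * (u 1 * u 2 * u 3 * u 4) = α ^ 4 * k 0 := by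
    rw [show k 0 * k 1 * k 2 * k 3 * k 4 * (u 1 * u 2 * u 3 * u 4) =
      (u 1 * k 1) * (u 2 * k 2) * (u 3 * k 3) * (u 4 * k 4) * k 0 by ring, h, h, h, h]
    ring
  have v1 : k 0 * k 1 * k 2 * k 3 * k 4 * (u 0 * u 2 * u 3 * u 4) = α ^ 4 * k 1 := by
    rw [show k 0 * k 1 * k 2 * k 3 * k 4 * (u 0 * u 2 * u 3 * u 4) =
      (u 0 * k 0) * (u 2 * k 2) * (u 3 * k 3) * (u 4 * k 4) * k 1 by ring, h, h, h, h]
    ring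
  have v2 : k 0 * k 1 * k 2 * k 3 * k 4 * (u 0 * u 1 * u 3 * u 4) = α ^ 4 * k 2 := by
    rw [show k 0 * k 1 * k 2 * k 3 * k 4 * (u 0 * u 1 * u 3 * u 4) =
      (u 0 * k 0) * (u 1 * k 1) * (u 3 * k 3) * (u 4 * k 4) * k 2 by ring, h, h, h, h]
    ring
  have v3 : k 0 * k 1 * k 2 * k 3 * k 4 * (u 0 * u 1 * u 2 * u 4) = α ^ 4 * k 3 := by
    rw [show k 0 * k 1 * k 2 * k 3 * k 4 * (u 0 * u 1 * u 2 * u 4) =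
      (u 0 * k 0) * (u 1 * k 1) * (u 2 * k 2) * (u 4 * k 4) * k 3 by ring, h, h, h, h]
    ring
  have v4 : k 0 * k 1 * k 2 * k 3 * k 4 * (u 0 * u 1 * u 2 * u 3) = α ^ 4 * k 4 := by
    rw [show k 0 * k 1 * k 2 * k 3 * k 4 * (u 0 * u 1 * u 2 * u 3) =
      (u 0 * k 0) * (u 1 * k 1) * (u 2 * k 2) * (u 3 * k 3) * k 4 by ring, h, h, h, h]
    ring
  ext i
  fin_cases i <;> simp [cofactorCoefficients]
  · linear_combination v1 - v0
  · linear_combination v3 - v2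
  · linear_combination v4
  · linear_combination v4 - v0 - v1
  · linear_combination v3 + v2 - v0 - v1

/-- A point over `y` comes from a point `t` of `ℙ¹`. -/
lemma exists_eq_smul_kleinCoefficients {p y : Fin 5 → ℂ} {s : ℂ} (hs : s ≠ 0)
    (h : hudsonCoefficients p = s • y) (hy : sectionFactor y ≠ 0) :
    ∃ t σ : ℂ, σ ≠ 0 ∧ p = σ • kleinCoefficients (cubicSection y) t := by
  have hf : sectionFactor (hudsonCoefficients p) ≠ 0 := by
    rw [h, sectionFactor_smul]
    exact mul_ne_zero (pow_ne_zero _ hs) hy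
  have hM := sectionM_hudsonCoefficients p
  have hN := sectionN_hudsonCoefficients p
  have hE : hudsonCoefficients p 4 = p 0 * p 1 * p 2 := rfl
  have hx : cubicSection (hudsonCoefficients p) = s ^ 3 • cubicSection y := by
    rw [h, cubicSection_smul]
  rw [sectionFactor, hM, hN, hE] at hf
  simp only [ne_eq, mul_eq_zero, not_or, pow_eq_zero_iff two_ne_zero, neg_eq_zero] at hf
  obtain ⟨⟨⟨-, ⟨hG, hB⟩, hD⟩, ⟨-, h56⟩, h36, h46⟩, -, ⟨h26, h16⟩, -⟩ := hf
  set n := sectionN (hudsonCoefficients p) with hn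
  have hn0 : n ≠ 0 := by
    rw [hN]
    exact mul_ne_zero (mul_ne_zero (neg_ne_zero.2 (mul_ne_zero hG hB)) h56) (mul_ne_zero h36 h46)
  -- The numbers `(-g, g, c - h, c + h, s) - t` are `α` times the inverses of the differences `k`
  -- between the last Klein coefficient and the others.
  set α := -2 * p 1 * p 2 * n * ((-p 0 - p 3 + p 2) * (p 0 - p 3 + p 2)) with hα
  have hα0 : α ≠ 0 := by simp [hα, hB, hD, hn0, h26, h16]
  set t := -2 * p 1 * p 2 * n * (p 3 - p 2) with ht
  set u := branchDifferences (cubicSection (hudsonCoefficients p)) t with hu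
  set k : Fin 5 → ℂ := ![-p 0 - p 3 + p 2, p 0 - p 3 + p 2, p 4 - p 1 - p 3 + p 2,
    p 4 + p 1 - p 3 + p 2, 2 * p 2] with hk
  have key := smul_cofactorCoefficients (k := k) (u := u) (α := α) fun i => by
    fin_cases i <;>
    · simp [hu, hα, ht, hk, branchDifferences, cubicSection, hM, ← hn]
      simp [hN, hudsonCoefficients]
      ring
  have hp : ![k 1 - k 0, k 3 - k 2, k 4, k 4 - k 0 - k 1, k 3 + k 2 - k 0 - k 1] = (2 : ℂ) • p := by
    ext i
    fin_cases i <;> simp [hk] <;> ring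
  have hks : kleinCoefficients (cubicSection (hudsonCoefficients p)) t =
      (s ^ 3) ^ 4 • kleinCoefficients (cubicSection y) (t / s ^ 3) := by
    rw [← kleinCoefficients_smul, hx, mul_div_cancel₀ _ (pow_ne_zero _ hs)]
  rw [← kleinCoefficients, hks, hp, smul_smul (α ^ 4), mul_comm _ (2 : ℂ)] at key
  set K := k 0 * k 1 * k 2 * k 3 * k 4 with hK
  have hK0 : K ≠ 0 := by simp [hK, hk, hD, h16, h26, h36, h46]
  have h2 : 2 * α ^ 4 ≠ 0 := mul_ne_zero two_ne_zero (pow_ne_zero _ hα0)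
  refine ⟨t / s ^ 3, (2 * α ^ 4)⁻¹ * (K * (s ^ 3) ^ 4),
    mul_ne_zero (inv_ne_zero h2) (mul_ne_zero hK0 (pow_ne_zero _ (pow_ne_zero _ hs))), ?_⟩
  rw [mul_smul, mul_smul, key, inv_smul_smul₀ h2]

/-- Different points `t` of `ℙ¹` give different Klein coefficients. -/
lemma eq_of_kleinCoefficients_eq_smul {x : Fin 4 → ℂ} {t t' σ : ℂ} (hx : x 0 ≠ 0) (hσ : σ ≠ 0)
    (ht : ∀ i, branchDifferences x t i ≠ 0)
    (h : kleinCoefficients x t' = σ • kleinCoefficients x t) : t = t' := by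
  have e0 := congrFun h 0
  have e2 := congrFun h 2
  have e3 := congrFun h 3
  simp only [kleinCoefficients, cofactorCoefficients, Pi.smul_apply, smul_eq_mul,
    Matrix.cons_val_zero, Matrix.cons_val] at e0 e2 e3
  set u := branchDifferences x t with hu
  set u' := branchDifferences x t' with hu'
  have v0 : u' 1 * u' 2 * u' 3 * u' 4 = σ * (u 1 * u 2 * u 3 * u 4) := by
    linear_combination (e2 - e3 - e0) / 2
  have v1 : u' 0 * u' 2 * u' 3 * u' 4 = σ * (u 0 * u 2 * u 3 * u 4) := by
    linear_combination (e2 - e3 + e0) / 2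
  have hm : (σ * u 2 * u 3 * u 4) * (u' 0 * u 1 - u' 1 * u 0) = 0 := by
    linear_combination u' 1 * v1 - u' 0 * v0
  have hm' := (mul_eq_zero.1 hm).resolve_left
    (mul_ne_zero (mul_ne_zero (mul_ne_zero hσ (ht 2)) (ht 3)) (ht 4))
  simp only [hu, hu', branchDifferences, Matrix.cons_val_zero, Matrix.cons_val_one] at hm'
  refine mul_left_cancel₀ (mul_ne_zero two_ne_zero hx) ?_
  linear_combination hm'

/-! ### The sixteen points of the Cartan subspace with given Klein coefficients -/

/-- The quartic relation between the Heisenberg-invariant quartics. -/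
def igusaQuartic {R : Type*} [CommRing R] (p : Fin 5 → R) : R :=
  (p 0 ^ 2 - p 1 ^ 2 - p 2 ^ 2 + 2 * p 3 * p 4) ^ 2 - 4 * (p 3 ^ 2 - p 1 ^ 2) * (p 4 ^ 2 - p 2 ^ 2)

lemma igusaQuartic_smul (c : ℂ) (p : Fin 5 → ℂ) :
    igusaQuartic (c • p) = c ^ 4 * igusaQuartic p := by
  simp [igusaQuartic]
  ring

lemma heisenbergQuartics_smul (c : ℂ) (a : Fin 4 → ℂ) :
    heisenbergQuartics Complex.I (c • a) = c ^ 4 • heisenbergQuartics Complex.I a := by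
  ext i
  fin_cases i <;> simp [heisenbergQuartics] <;> ring

/-- The coordinates in which the Heisenberg-invariant quartics are products and squares of sums of
squares. -/
def rotate (a : Fin 4 → ℂ) : Fin 4 → ℂ := ![a 0 + a 1, a 0 - a 1, a 2 + a 3, a 3 - a 2]

lemma rotate_smul (c : ℂ) (a : Fin 4 → ℂ) : rotate (c • a) = c • rotate a := by
  ext i
  fin_cases i <;> simp [rotate] <;> ring

/-- Half the sum minus the coordinates, an involution. -/
noncomputable def halfSum (X : Fin 4 → ℂ) (i : Fin 4) : ℂ := (∑ j, X j) / 2 - X i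

lemma halfSum_halfSum (X : Fin 4 → ℂ) : halfSum (halfSum X) = X := by
  ext i
  simp [halfSum, Fin.sum_univ_four]
  ring

lemma halfSum_smul (c : ℂ) (X : Fin 4 → ℂ) : halfSum (c • X) = c • halfSum X := by
  ext i
  simp [halfSum, Fin.sum_univ_four]
  ring

/-- The squares of the four numbers `Y`. -/
def squareTargets {R : Type*} [CommRing R] (p : Fin 5 → R) : Fin 4 → R :=
  ![p 4 + p 2, p 4 - p 2, p 3 - p 1, p 3 + p 1]

/-- The equations `heisenbergQuartics I a = p` in terms of the rotated coordinates `b`: with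
`Y = halfSum (b²)`, they prescribe the squares of the `Yᵢ` and the product of the `bᵢ`. -/
lemma heisenbergQuartics_eq_iff (a : Fin 4 → ℂ) (p : Fin 5 → ℂ) :
    heisenbergQuartics Complex.I a = p ↔
      2 * Complex.I * ∏ i, rotate a i = p 0 ∧
        halfSum (rotate a ^ 2) ^ 2 = squareTargets p := by
  have hy : halfSum (rotate a ^ 2) ^ 2 = squareTargets (heisenbergQuartics Complex.I a) := by
    ext i
    fin_cases i <;>
      simp [halfSum, Fin.sum_univ_four, squareTargets, heisenbergQuartics, rotate] <;> ring
  have hg : 2 * Complex.I * ∏ i, rotate a i = heisenbergQuartics Complex.I a 0 := by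
    simp [Fin.prod_univ_four, heisenbergQuartics, rotate]
    ring
  rw [hy, hg]
  refine ⟨fun h => by simp [h], fun ⟨h0, h⟩ => ?_⟩
  have e0 := congrFun h 0
  have e1 := congrFun h 1
  have e2 := congrFun h 2
  have e3 := congrFun h 3
  simp only [squareTargets, Matrix.cons_val_zero, Matrix.cons_val_one, Matrix.cons_val] at e0 e1 e2 e3
  have h1 : heisenbergQuartics Complex.I a 1 = p 1 := by linear_combination (e3 - e2) / 2
  have h2 : heisenbergQuartics Complex.I a 2 = p 2 := by linear_combination (e0 - e1) / 2
  have h3 : heisenbergQuartics Complex.I a 3 = p 3 := by linear_combination (e3 + e2) / 2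
  have h4 : heisenbergQuartics Complex.I a 4 = p 4 := by linear_combination (e0 + e1) / 2
  ext i
  fin_cases i <;> assumption

/-- The product of the `Xᵢ` in terms of the squares and the product of the `Yᵢ`. -/
lemma four_mul_prod_of_halfSum_sq {X : Fin 4 → ℂ} {p : Fin 5 → ℂ}
    (h : halfSum X ^ 2 = squareTargets p) :
    4 * ∏ i, X i = 2 * p 3 * p 4 - p 1 ^ 2 - p 2 ^ 2 + 2 * ∏ i, halfSum X i := by
  obtain ⟨Y, hY⟩ : ∃ Y, halfSum X = Y := ⟨_, rfl⟩
  have hX : X = halfSum Y := by rw [← hY, halfSum_halfSum]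
  rw [hY] at h ⊢
  have e0 : Y 0 ^ 2 = p 4 + p 2 := congrFun h 0
  have e1 : Y 1 ^ 2 = p 4 - p 2 := congrFun h 1
  have e2 : Y 2 ^ 2 = p 3 - p 1 := congrFun h 2
  have e3 : Y 3 ^ 2 = p 3 + p 1 := congrFun h 3
  have p1 : p 1 = (Y 3 ^ 2 - Y 2 ^ 2) / 2 := by linear_combination (e2 - e3) / 2
  have p2 : p 2 = (Y 0 ^ 2 - Y 1 ^ 2) / 2 := by linear_combination (e1 - e0) / 2
  have p3 : p 3 = (Y 3 ^ 2 + Y 2 ^ 2) / 2 := by linear_combination -(e2 + e3) / 2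
  have p4 : p 4 = (Y 0 ^ 2 + Y 1 ^ 2) / 2 := by linear_combination -(e1 + e0) / 2
  rw [hX, p1, p2, p3, p4]
  simp only [halfSum, Fin.sum_univ_four, Fin.prod_univ_four]
  ring

lemma prod_squareTargets (p : Fin 5 → ℂ) :
    ∏ i, squareTargets p i = (p 3 ^ 2 - p 1 ^ 2) * (p 4 ^ 2 - p 2 ^ 2) := by
  simp [Fin.prod_univ_four, squareTargets]
  ring

/-- The product of the `Yᵢ` is determined by the Heisenberg-invariant quartics. -/
lemma two_mul_prod_halfSum {a : Fin 4 → ℂ} {p : Fin 5 → ℂ}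
    (h : heisenbergQuartics Complex.I a = p) :
    2 * ∏ i, halfSum (rotate a ^ 2) i = -(p 0 ^ 2 - p 1 ^ 2 - p 2 ^ 2 + 2 * p 3 * p 4) := by
  obtain ⟨h0, h1⟩ := (heisenbergQuartics_eq_iff a p).1 h
  have h2 := four_mul_prod_of_halfSum_sq h1
  simp only [Pi.pow_apply, Finset.prod_pow] at h2
  linear_combination -h2 - (p 0 + 2 * Complex.I * ∏ i, rotate a i) * h0
    + 4 * (∏ i, rotate a i) ^ 2 * Complex.I_sq

lemma igusaQuartic_heisenbergQuartics (a : Fin 4 → ℂ) :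
    igusaQuartic (heisenbergQuartics Complex.I a) = 0 := by
  have h := two_mul_prod_halfSum (a := a) rfl
  have h1 := ((heisenbergQuartics_eq_iff a _).1 rfl).2
  have h2 := congrArg (fun Y : Fin 4 → ℂ => ∏ i, Y i) h1
  simp only [Pi.pow_apply, Finset.prod_pow, prod_squareTargets] at h2
  rw [igusaQuartic, mul_assoc 4, ← h2, ← neg_sq (_ + _), ← h]
  ring

/-- Four square roots with prescribed product and first entry depend on two signs. -/
lemma exists_signed_roots {T : Fin 4 → ℂ} (hT : ∀ i, T i ≠ 0) {m r : ℂ} (hm : m ^ 2 = ∏ i, T i)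
    (hr : r ^ 2 = T 0) : ∃ f : ℤˣ × ℤˣ → Fin 4 → ℂ, Function.Injective f ∧
      ∀ Y, Y ∈ Set.range f ↔ Y ^ 2 = T ∧ ∏ i, Y i = m ∧ Y 0 = r := by
  have hsq (z : ℂ) : ∃ w, w ^ 2 = z := IsAlgClosed.exists_pow_nat_eq z two_pos
  obtain ⟨r₁, h₁⟩ := hsq (T 1)
  obtain ⟨r₂, h₂⟩ := hsq (T 2)
  have n0 : r ≠ 0 := fun h => hT 0 (by rw [← hr, h, zero_pow two_ne_zero])
  have n1 : r₁ ≠ 0 := fun h => hT 1 (by rw [← h₁, h, zero_pow two_ne_zero])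
  have n2 : r₂ ≠ 0 := fun h => hT 2 (by rw [← h₂, h, zero_pow two_ne_zero])
  have hu (ε : ℤˣ) : ((ε : ℤ) : ℂ) ≠ 0 := by exact_mod_cast ε.ne_zero
  have hu2 (ε : ℤˣ) : ((ε : ℤ) : ℂ) ^ 2 = 1 := by
    rcases Int.units_eq_one_or ε with rfl | rfl <;> norm_num
  have hex {z w : ℂ} (h : z ^ 2 = w ^ 2) : ∃ ε : ℤˣ, z = ((ε : ℤ) : ℂ) * w := by
    rcases sq_eq_sq_iff_eq_or_eq_neg.1 h with h | h
    · exact ⟨1, by simp [h]⟩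
    · exact ⟨-1, by simp [h]⟩
  refine ⟨fun ε => ![r, ((ε.1 : ℤ) : ℂ) * r₁, ((ε.2 : ℤ) : ℂ) * r₂,
    m / (r * (((ε.1 : ℤ) : ℂ) * r₁) * (((ε.2 : ℤ) : ℂ) * r₂))], fun ε δ h => ?_, fun Y => ?_⟩
  · have e1 := mul_right_cancel₀ n1 (congrFun h 1)
    have e2 := mul_right_cancel₀ n2 (congrFun h 2)
    exact Prod.ext (Units.ext (by exact_mod_cast e1)) (Units.ext (by exact_mod_cast e2))
  · constructor
    · rintro ⟨ε, rfl⟩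
      have hd : r * (((ε.1 : ℤ) : ℂ) * r₁) * (((ε.2 : ℤ) : ℂ) * r₂) ≠ 0 :=
        mul_ne_zero (mul_ne_zero n0 (mul_ne_zero (hu _) n1)) (mul_ne_zero (hu _) n2)
      refine ⟨?_, ?_, rfl⟩
      · ext i
        fin_cases i
        · simp [hr]
        · simp [mul_pow, hu2, h₁]
        · simp [mul_pow, hu2, h₂]
        · simp only [Fin.prod_univ_four] at hm
          simp [div_pow, mul_pow, hu2, h₁, h₂, hr, hm]
          field_simp [hT 0, hT 1, hT 2]
      · simp only [Fin.prod_univ_four, Matrix.cons_val_zero, Matrix.cons_val_one, Matrix.cons_val]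
        exact mul_div_cancel₀ _ hd
    · rintro ⟨hY, hYm, hY0⟩
      have hY' (i : Fin 4) : Y i ^ 2 = T i := congrFun hY i
      obtain ⟨ε, hε⟩ := hex ((hY' 1).trans h₁.symm)
      obtain ⟨δ, hδ⟩ := hex ((hY' 2).trans h₂.symm)
      refine ⟨(ε, δ), ?_⟩
      have hd : r * (((ε : ℤ) : ℂ) * r₁) * (((δ : ℤ) : ℂ) * r₂) ≠ 0 :=
        mul_ne_zero (mul_ne_zero n0 (mul_ne_zero (hu _) n1)) (mul_ne_zero (hu _) n2)
      ext i
      fin_cases i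
      · exact hY0.symm
      · exact hε.symm
      · exact hδ.symm
      · rw [← hYm, Fin.prod_univ_four, hY0, hε, hδ]
        exact mul_div_cancel_left₀ _ hd

/-- The inverse of `rotate`. -/
noncomputable def unrotate (b : Fin 4 → ℂ) : Fin 4 → ℂ :=
  ![(b 0 + b 1) / 2, (b 0 - b 1) / 2, (b 2 - b 3) / 2, (b 2 + b 3) / 2]

lemma rotate_unrotate (b : Fin 4 → ℂ) : rotate (unrotate b) = b := by
  ext i
  fin_cases i <;> simp [rotate, unrotate] <;> ring

lemma rotate_injective : Function.Injective rotate := by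
  intro a b h
  have h0 : a 0 + a 1 = b 0 + b 1 := congrFun h 0
  have h1 : a 0 - a 1 = b 0 - b 1 := congrFun h 1
  have h2 : a 2 + a 3 = b 2 + b 3 := congrFun h 2
  have h3 : a 3 - a 2 = b 3 - b 2 := congrFun h 3
  ext i
  fin_cases i
  · linear_combination (norm := (simp; ring)) (h0 + h1) / 2
  · linear_combination (norm := (simp; ring)) (h0 - h1) / 2
  · linear_combination (norm := (simp; ring)) (h2 - h3) / 2
  · linear_combination (norm := (simp; ring)) (h2 + h3) / 2

/-- A point of the Igusa quartic outside of the coordinate hyperplanes comes from sixteen points of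
`ℙ³`, which are indexed by four signs. -/
lemma exists_sixteen_points {p : Fin 5 → ℂ} (hp : igusaQuartic p = 0) (h0 : p 0 ≠ 0)
    (hT : ∀ i, squareTargets p i ≠ 0) :
    ∃ f : (ℤˣ × ℤˣ) × (ℤˣ × ℤˣ) → ℙ ℂ (Fin 4 → ℂ), Function.Injective f ∧
      ∀ q, q ∈ Set.range f ↔ ∃ σ : ℂ, σ ≠ 0 ∧ heisenbergQuartics Complex.I q.rep = σ • p := by
  have hsq (z : ℂ) : ∃ w, w ^ 2 = z := IsAlgClosed.exists_pow_nat_eq z two_pos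
  obtain ⟨r, hr⟩ := hsq (squareTargets p 0)
  have hr0 : r ≠ 0 := fun h => hT 0 (by rw [← hr, h, zero_pow two_ne_zero])
  set m := -(p 0 ^ 2 - p 1 ^ 2 - p 2 ^ 2 + 2 * p 3 * p 4) / 2 with hm
  obtain ⟨f, hf, hfr⟩ := exists_signed_roots hT (m := m) (r := r) (by
    rw [prod_squareTargets]
    rw [igusaQuartic] at hp
    linear_combination hp / 4) hr
  have hf' (ε) := (hfr (f ε)).1 ⟨ε, rfl⟩
  set e := p 0 / (2 * Complex.I) with he
  have h2I : 2 * Complex.I ≠ 0 := mul_ne_zero two_ne_zero Complex.I_ne_zero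
  have he0 : e ≠ 0 := div_ne_zero h0 h2I
  have he2 : e ^ 2 = -p 0 ^ 2 / 4 := by
    rw [he, div_pow, mul_pow, Complex.I_sq]
    ring
  have hX (ε) : e ^ 2 = ∏ i, halfSum (f ε) i := by
    have h1 := four_mul_prod_of_halfSum_sq (X := halfSum (f ε)) (p := p)
      (by rw [halfSum_halfSum, (hf' ε).1])
    rw [halfSum_halfSum, (hf' ε).2.1] at h1
    linear_combination he2 - h1 / 4 - hm / 2
  have hX0 (ε) (i) : halfSum (f ε) i ≠ 0 :=
    Finset.prod_ne_zero_iff.1 (hX ε ▸ pow_ne_zero 2 he0) i (Finset.mem_univ i)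
  choose s hs using fun ε => hsq (halfSum (f ε) 0)
  choose g hg hgr using fun ε => exists_signed_roots (hX0 ε) (hX ε) (hs ε)
  have hg' (ε) (δ) := (hgr ε (g ε δ)).1 ⟨δ, rfl⟩
  have hheis (ε) (δ) : heisenbergQuartics Complex.I (unrotate (g ε δ)) = p := by
    rw [heisenbergQuartics_eq_iff, rotate_unrotate, (hg' ε δ).1, (hg' ε δ).2.1, halfSum_halfSum,
      (hf' ε).1]
    exact ⟨mul_div_cancel₀ _ h2I, rfl⟩
  have hne (ε) (δ) : unrotate (g ε δ) ≠ 0 := fun h => h0 (by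
    rw [← hheis ε δ, h]
    simp [heisenbergQuartics])
  refine ⟨fun ε => Projectivization.mk ℂ (unrotate (g ε.1 ε.2)) (hne _ _), ?_, fun q => ?_⟩
  · rintro ⟨ε, δ⟩ ⟨ε', δ'⟩ h
    obtain ⟨z, hz⟩ := (Projectivization.mk_eq_mk_iff' ℂ _ _ _ _).1 h
    have hb : g ε δ = z • g ε' δ' := by
      rw [← rotate_unrotate (g ε δ), ← hz, rotate_smul, rotate_unrotate]
    have hy : f ε = z ^ 2 • f ε' := by
      rw [← halfSum_halfSum (f ε), ← (hg' ε δ).1, hb, smul_pow, halfSum_smul, (hg' ε' δ').1,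
        halfSum_halfSum]
    have hz2 : z ^ 2 = 1 := by
      have := congrFun hy 0
      rw [Pi.smul_apply, (hf' ε).2.2, (hf' ε').2.2, smul_eq_mul] at this
      exact mul_right_cancel₀ hr0 (by rw [← this, one_mul])
    obtain rfl : ε = ε' := hf (by rw [hy, hz2, one_smul])
    have hs0 : s ε ≠ 0 := fun h => hX0 ε 0 (by rw [← hs, h, zero_pow two_ne_zero])
    have hz1 : z = 1 := by
      have := congrFun hb 0
      rw [Pi.smul_apply, (hg' ε δ).2.2, (hg' ε δ').2.2, smul_eq_mul] at this
      exact mul_right_cancel₀ hs0 (by rw [← this, one_mul])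
    obtain rfl : δ = δ' := hg ε (by rw [hb, hz1, one_smul])
    rfl
  · constructor
    · rintro ⟨ε, rfl⟩
      obtain ⟨z, hz⟩ := (Projectivization.mk_eq_mk_iff' ℂ _ _ (Projectivization.rep_nonzero _)
        (hne ε.1 ε.2)).1 (Projectivization.mk_rep (Projectivization.mk ℂ _ (hne ε.1 ε.2)))
      refine ⟨z ^ 4, pow_ne_zero 4 ?_, ?_⟩
      · rintro rfl
        exact Projectivization.rep_nonzero _ (by rw [← hz, zero_smul])
      · dsimp only
        rw [← hz, heisenbergQuartics_smul, hheis]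
    · rintro ⟨σ, hσ, hq⟩
      -- Multiples of the representative by roots of unity have the required values `r` and `s`.
      obtain ⟨z₁, hz₁⟩ := IsAlgClosed.exists_pow_nat_eq σ⁻¹ (n := 4) (by norm_num)
      have h1 : heisenbergQuartics Complex.I (z₁ • q.rep) = p := by
        rw [heisenbergQuartics_smul, hq, hz₁, inv_smul_smul₀ hσ]
      obtain ⟨z₂, hz₂, h2⟩ : ∃ z₂ : ℂ, z₂ ^ 4 = 1 ∧
          halfSum (rotate (z₂ • z₁ • q.rep) ^ 2) 0 = r := by
        have hy0 := congrFun ((heisenbergQuartics_eq_iff _ p).1 h1).2 0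
        rw [← hr, Pi.pow_apply, sq_eq_sq_iff_eq_or_eq_neg] at hy0
        rcases hy0 with h | h
        · exact ⟨1, one_pow 4, by rw [one_smul, h]⟩
        · refine ⟨Complex.I, Complex.I_pow_four, ?_⟩
          rw [rotate_smul, smul_pow, halfSum_smul, Pi.smul_apply, h, Complex.I_sq, smul_eq_mul]
          ring
      set a := z₂ • z₁ • q.rep with ha
      have h3 : heisenbergQuartics Complex.I a = p := by
        rw [ha, heisenbergQuartics_smul, hz₂, h1, one_smul]
      obtain ⟨ε, hε⟩ := (hfr (halfSum (rotate a ^ 2))).2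
        ⟨((heisenbergQuartics_eq_iff _ p).1 h3).2, by
          rw [hm, ← two_mul_prod_halfSum h3, mul_div_cancel_left₀ _ two_ne_zero], h2⟩
      have hε' : rotate a ^ 2 = halfSum (f ε) := by rw [hε, halfSum_halfSum]
      obtain ⟨z₃, hz₃, h4⟩ : ∃ z₃ : ℂ, z₃ ^ 2 = 1 ∧ rotate (z₃ • a) 0 = s ε := by
        have hb0 := congrFun hε' 0
        rw [← hs, Pi.pow_apply, sq_eq_sq_iff_eq_or_eq_neg] at hb0
        rcases hb0 with h | h
        · exact ⟨1, one_pow 2, by rw [one_smul, h]⟩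
        · exact ⟨-1, by norm_num, by rw [rotate_smul, Pi.smul_apply, h]; simp⟩
      have h5 : heisenbergQuartics Complex.I (z₃ • a) = p := by
        rw [heisenbergQuartics_smul, show z₃ ^ 4 = (z₃ ^ 2) ^ 2 by ring, hz₃, h3, one_pow, one_smul]
      obtain ⟨δ, hδ⟩ := (hgr ε (rotate (z₃ • a))).2
        ⟨by rw [rotate_smul, smul_pow, hz₃, one_smul, hε'], by
          rw [he, ← ((heisenbergQuartics_eq_iff _ p).1 h5).1, mul_div_cancel_left₀ _ h2I], h4⟩
      refine ⟨(ε, δ), ?_⟩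
      rw [← Projectivization.mk_rep q, Projectivization.mk_eq_mk_iff']
      refine ⟨z₃ * z₂ * z₁, rotate_injective ?_⟩
      rw [rotate_unrotate, hδ, ha, mul_smul, mul_smul]

/-! ### The general fibre -/

/-- The polynomial of degree sixteen whose roots are the points `t` of `ℙ¹` for which the Klein
coefficients lie on the Igusa quartic. -/
noncomputable def fiberPolynomial {R : Type*} [CommRing R] (y : Fin 5 → R) : Polynomial R :=
  igusaQuartic (kleinCoefficients (Polynomial.C ∘ cubicSection y) Polynomial.X)

/-- The polynomial whose roots are the points `t` of `ℙ¹` which have to be avoided. -/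
noncomputable def degeneracyPolynomial {R : Type*} [CommRing R] (y : Fin 5 → R) : Polynomial R :=
  (∏ i, squareTargets (kleinCoefficients (Polynomial.C ∘ cubicSection y) Polynomial.X) i) *
    ∏ i, branchDifferences (Polynomial.C ∘ cubicSection y) Polynomial.X i

section
variable {R S : Type*} [CommRing R] [CommRing S] (φ : R →+* S)

lemma map_igusaQuartic (p : Fin 5 → R) : φ (igusaQuartic p) = igusaQuartic (φ ∘ p) := by
  simp [igusaQuartic, map_ofNat]

lemma map_squareTargets (p : Fin 5 → R) (i : Fin 4) :
    φ (squareTargets p i) = squareTargets (φ ∘ p) i := by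
  fin_cases i <;> simp [squareTargets]

lemma map_comp_cubicSection (y : Fin 5 → R) :
    Polynomial.mapRingHom φ ∘ Polynomial.C ∘ cubicSection y =
      Polynomial.C ∘ cubicSection (φ ∘ y) := by
  ext1 i
  rw [Function.comp_apply, Function.comp_apply, Polynomial.coe_mapRingHom, Polynomial.map_C,
    map_cubicSection, Function.comp_apply]

lemma map_fiberPolynomial (y : Fin 5 → R) :
    (fiberPolynomial y).map φ = fiberPolynomial (φ ∘ y) := by
  rw [← Polynomial.coe_mapRingHom, fiberPolynomial, map_igusaQuartic, fiberPolynomial]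
  congr 1
  ext1 i
  rw [Function.comp_apply, map_kleinCoefficients, map_comp_cubicSection, Polynomial.coe_mapRingHom,
    Polynomial.map_X]

lemma map_degeneracyPolynomial (y : Fin 5 → R) :
    (degeneracyPolynomial y).map φ = degeneracyPolynomial (φ ∘ y) := by
  rw [← Polynomial.coe_mapRingHom, degeneracyPolynomial, map_mul, map_prod, map_prod,
    degeneracyPolynomial]
  congr 1
  · refine Finset.prod_congr rfl fun i _ => ?_
    rw [map_squareTargets]
    congr 1
    ext1 i
    rw [Function.comp_apply, map_kleinCoefficients, map_comp_cubicSection,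
      Polynomial.coe_mapRingHom, Polynomial.map_X]
  · refine Finset.prod_congr rfl fun i _ => ?_
    rw [map_branchDifferences, map_comp_cubicSection, Polynomial.coe_mapRingHom, Polynomial.map_X]

lemma evalRingHom_comp_C (t : R) (x : Fin 4 → R) :
    Polynomial.evalRingHom t ∘ Polynomial.C ∘ x = x := by
  ext1 i
  simp

lemma eval_fiberPolynomial (y : Fin 5 → R) (t : R) :
    (fiberPolynomial y).eval t = igusaQuartic (kleinCoefficients (cubicSection y) t) := by
  rw [← Polynomial.coe_evalRingHom, fiberPolynomial, map_igusaQuartic]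
  congr 1
  ext1 i
  rw [Function.comp_apply, map_kleinCoefficients, evalRingHom_comp_C, Polynomial.coe_evalRingHom,
    Polynomial.eval_X]

lemma eval_degeneracyPolynomial (y : Fin 5 → R) (t : R) :
    (degeneracyPolynomial y).eval t = (∏ i, squareTargets (kleinCoefficients (cubicSection y) t) i) *
      ∏ i, branchDifferences (cubicSection y) t i := by
  rw [← Polynomial.coe_evalRingHom, degeneracyPolynomial, map_mul, map_prod, map_prod]
  congr 1
  · refine Finset.prod_congr rfl fun i _ => ?_
    rw [map_squareTargets]
    congr 1
    ext1 i
    rw [Function.comp_apply, map_kleinCoefficients, evalRingHom_comp_C,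
      Polynomial.coe_evalRingHom, Polynomial.eval_X]
  · refine Finset.prod_congr rfl fun i _ => ?_
    rw [map_branchDifferences, evalRingHom_comp_C, Polynomial.coe_evalRingHom, Polynomial.eval_X]

/-- The polynomial `f` has degree at most `n`, and `c` is its coefficient of degree `n`. -/
def HasTopCoeff (f : Polynomial R) (n : ℕ) (c : R) : Prop := f.natDegree ≤ n ∧ f.coeff n = c

lemma HasTopCoeff.add {f g : Polynomial R} {n : ℕ} {c d : R} (hf : HasTopCoeff f n c)
    (hg : HasTopCoeff g n d) : HasTopCoeff (f + g) n (c + d) :=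
  ⟨Polynomial.natDegree_add_le_of_degree_le hf.1 hg.1, by rw [Polynomial.coeff_add, hf.2, hg.2]⟩

lemma HasTopCoeff.sub {f g : Polynomial R} {n : ℕ} {c d : R} (hf : HasTopCoeff f n c)
    (hg : HasTopCoeff g n d) : HasTopCoeff (f - g) n (c - d) :=
  ⟨(Polynomial.natDegree_sub_le_of_le hf.1 hg.1).trans_eq (max_self n), by
    rw [Polynomial.coeff_sub, hf.2, hg.2]⟩

lemma HasTopCoeff.mul {f g : Polynomial R} {m n : ℕ} {c d : R} (hf : HasTopCoeff f m c)
    (hg : HasTopCoeff g n d) : HasTopCoeff (f * g) (m + n) (c * d) :=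
  ⟨Polynomial.natDegree_mul_le_of_le hf.1 hg.1, by
    rw [Polynomial.coeff_mul_add_eq_of_natDegree_le hf.1 hg.1, hf.2, hg.2]⟩

lemma hasTopCoeff_ofNat (n : ℕ) [n.AtLeastTwo] :
    HasTopCoeff (OfNat.ofNat n : Polynomial R) 0 (OfNat.ofNat n) :=
  ⟨(Polynomial.natDegree_ofNat n).le, by simp⟩

lemma HasTopCoeff.congr {f g : Polynomial R} {m n : ℕ} {c d : R} (hf : HasTopCoeff f m c)
    (h : f = g) (hn : m = n) (hc : c = d) : HasTopCoeff g n d := h ▸ hn ▸ hc ▸ hf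

lemma HasTopCoeff.derivative {f : Polynomial R} {n : ℕ} {c : R} (hf : HasTopCoeff f (n + 1) c) :
    HasTopCoeff (Polynomial.derivative f) n (c * (n + 1)) :=
  ⟨(Polynomial.natDegree_derivative_le f).trans (Nat.sub_le_of_le_add hf.1), by
    rw [Polynomial.coeff_derivative, hf.2]⟩

lemma hasTopCoeff_branchDifferences (x : Fin 4 → R) (i : Fin 5) :
    HasTopCoeff (branchDifferences (Polynomial.C ∘ x) Polynomial.X i) 1 (-1) := by
  have h (c : R) : HasTopCoeff (Polynomial.C c - Polynomial.X) 1 (-1) :=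
    ⟨by compute_degree, by simp⟩
  fin_cases i <;> simp only [branchDifferences]
  · exact (h (-x 0)).congr (by simp) rfl rfl
  · exact h (x 0)
  · exact (h (x 2 - x 1)).congr (by simp) rfl rfl
  · exact (h (x 2 + x 1)).congr (by simp) rfl rfl
  · exact h (x 3)

lemma hasTopCoeff_kleinCoefficients (x : Fin 4 → R) (i : Fin 5) :
    HasTopCoeff (kleinCoefficients (Polynomial.C ∘ x) Polynomial.X i) 4
      ((![0, 0, 1, -1, 0] : Fin 5 → R) i) := by
  have h (i j k l : Fin 5) := (((hasTopCoeff_branchDifferences x i).mul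
    (hasTopCoeff_branchDifferences x j)).mul (hasTopCoeff_branchDifferences x k)).mul
    (hasTopCoeff_branchDifferences x l)
  fin_cases i
  · exact ((h 0 2 3 4).sub (h 1 2 3 4)).congr rfl rfl (by simp)
  · exact ((h 0 1 2 4).sub (h 0 1 3 4)).congr rfl rfl (by simp)
  · exact (h 0 1 2 3).congr rfl rfl (by simp)
  · exact (((h 0 1 2 3).sub (h 1 2 3 4)).sub (h 0 2 3 4)).congr rfl rfl (by simp)
  · exact ((((h 0 1 3 4).add (h 0 1 2 4)).sub (h 1 2 3 4)).sub (h 0 2 3 4)).congr rfl rfl (by simp)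

lemma hasTopCoeff_fiberPolynomial (y : Fin 5 → R) : HasTopCoeff (fiberPolynomial y) 16 5 := by
  have h := hasTopCoeff_kleinCoefficients (cubicSection y)
  have h2 (i : Fin 5) := (h i).mul (h i)
  have h34 := ((hasTopCoeff_ofNat 2).mul (h 3)).mul (h 4)
  have ha := (((h2 0).sub (h2 1)).sub (h2 2)).add (h34.congr rfl (by norm_num) rfl)
  refine ((ha.mul ha).sub ((((hasTopCoeff_ofNat 4).mul ((h2 3).sub (h2 1))).mul
    ((h2 4).sub (h2 2))).congr rfl (by norm_num) rfl)).congr ?_ (by norm_num) ?_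
  · simp only [fiberPolynomial, igusaQuartic]
    ring
  · simp
    norm_num

lemma hasTopCoeff_degeneracyPolynomial (y : Fin 5 → R) :
    HasTopCoeff (degeneracyPolynomial y) 21 1 := by
  have h := hasTopCoeff_kleinCoefficients (cubicSection y)
  have hu := hasTopCoeff_branchDifferences (cubicSection y)
  refine ((((((h 4).add (h 2)).mul ((h 4).sub (h 2))).mul ((h 3).sub (h 1))).mul
    ((h 3).add (h 1))).mul (((((hu 0).mul (hu 1)).mul (hu 2)).mul (hu 3)).mul (hu 4))).congr
    ?_ (by norm_num) ?_
  · simp [degeneracyPolynomial, Fin.prod_univ_succ, squareTargets]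
    ring
  · simp

end

/-- The polynomial whose non-vanishing at a point `y` of the cubic threefold ensures that the fibre
over `y` consists of `256` points. -/
noncomputable def genericityPolynomial : MvPolynomial (Fin 5) ℂ :=
  sectionFactor MvPolynomial.X * (fiberPolynomial MvPolynomial.X).resultant
    (Polynomial.derivative (fiberPolynomial MvPolynomial.X) * degeneracyPolynomial MvPolynomial.X)
    16 36

lemma eval_genericityPolynomial (y : Fin 5 → ℂ) :
    MvPolynomial.eval y genericityPolynomial = sectionFactor y * (fiberPolynomial y).resultant
      (Polynomial.derivative (fiberPolynomial y) * degeneracyPolynomial y) 16 36 := by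
  have hy : ⇑(MvPolynomial.eval y) ∘ (MvPolynomial.X : Fin 5 → MvPolynomial (Fin 5) ℂ) = y := by
    ext1 i
    simp
  rw [genericityPolynomial, map_mul, map_sectionFactor, ← Polynomial.resultant_map_map,
    Polynomial.map_mul, ← Polynomial.derivative_map, map_fiberPolynomial, map_degeneracyPolynomial,
    hy]

lemma hasTopCoeff_derivative_mul_degeneracyPolynomial (y : Fin 5 → ℂ) :
    HasTopCoeff (Polynomial.derivative (fiberPolynomial y) * degeneracyPolynomial y) 36 80 :=
  ((hasTopCoeff_fiberPolynomial y).derivative.mul (hasTopCoeff_degeneracyPolynomial y)).congr rfl rfl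
    (by norm_num)

lemma HasTopCoeff.natDegree_eq {f : Polynomial ℂ} {n : ℕ} {c : ℂ} (hf : HasTopCoeff f n c)
    (hc : c ≠ 0) : f.natDegree = n :=
  Polynomial.natDegree_eq_of_le_of_coeff_ne_zero hf.1 (hf.2 ▸ hc)

lemma eval_genericityPolynomial_ne_zero_iff (y : Fin 5 → ℂ) :
    MvPolynomial.eval y genericityPolynomial ≠ 0 ↔ sectionFactor y ≠ 0 ∧
      ∀ t, (fiberPolynomial y).eval t = 0 →
        (Polynomial.derivative (fiberPolynomial y)).eval t ≠ 0 ∧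
        (∀ i, squareTargets (kleinCoefficients (cubicSection y) t) i ≠ 0) ∧
        ∀ i, branchDifferences (cubicSection y) t i ≠ 0 := by
  have hf := hasTopCoeff_fiberPolynomial y
  have hg := hasTopCoeff_derivative_mul_degeneracyPolynomial y
  have hf' := hf.natDegree_eq (by norm_num)
  have hg' := hg.natDegree_eq (by norm_num)
  have hf0 : fiberPolynomial y ≠ 0 := by
    rintro h
    rw [h] at hf'
    simp at hf'
  have h := Polynomial.resultant_eq_zero_iff (f := fiberPolynomial y)
    (g := Polynomial.derivative (fiberPolynomial y) * degeneracyPolynomial y)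
  rw [hf', hg'] at h
  rw [eval_genericityPolynomial, mul_ne_zero_iff, ne_eq (Polynomial.resultant _ _ _ _), h]
  refine and_congr_right fun _ => ?_
  rw [not_and_not_right, Polynomial.isCoprime_iff_aeval_ne_zero_of_isAlgClosed ℂ ℂ]
  simp only [Polynomial.coe_aeval_eq_eval, Polynomial.eval_mul, eval_degeneracyPolynomial,
    mul_ne_zero_iff, Finset.prod_ne_zero_iff, Finset.mem_univ, true_imp_iff, hf0, ne_eq,
    not_false_eq_true, true_or]
  exact forall_congr' fun t => ⟨fun h h' => h.resolve_left (not_not.2 h'), fun h =>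
    (em _).elim (fun h' => Or.inr (h h')) Or.inl⟩

lemma card_roots_fiberPolynomial {y : Fin 5 → ℂ}
    (hy : MvPolynomial.eval y genericityPolynomial ≠ 0) :
    (fiberPolynomial y).roots.toFinset.card = 16 := by
  rw [eval_genericityPolynomial_ne_zero_iff] at hy
  have hd := (hasTopCoeff_fiberPolynomial y).natDegree_eq (by norm_num)
  have hsep : (fiberPolynomial y).Separable := by
    rw [Polynomial.Separable, Polynomial.isCoprime_iff_aeval_ne_zero_of_isAlgClosed ℂ ℂ]
    intro t
    simp only [Polynomial.coe_aeval_eq_eval]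
    by_cases h : (fiberPolynomial y).eval t = 0
    · exact Or.inr (hy.2 t h).1
    · exact Or.inl h
  rw [Multiset.toFinset_card_of_nodup (Polynomial.nodup_roots hsep),
    IsAlgClosed.card_roots_eq_natDegree, hd]

lemma ratMapsTo_kummerCoefficients_iff {q : ℙ ℂ (Fin 4 → ℂ)} {y : Fin 5 → ℂ} (hy : y ≠ 0) :
    RatMapsTo kummerCoefficients q (Projectivization.mk ℂ y hy) ↔
      ∃ s : ℂ, s ≠ 0 ∧ hudsonCoefficients (heisenbergQuartics Complex.I q.rep) = s • y := by
  have h8 : 8 * Complex.I ≠ 0 := mul_ne_zero (by norm_num) Complex.I_ne_zero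
  have he : (fun i => MvPolynomial.eval q.rep (kummerCoefficients i)) =
      (8 * Complex.I) • hudsonCoefficients (heisenbergQuartics Complex.I q.rep) :=
    funext fun i => eval_kummerCoefficients _ i
  constructor
  · rintro ⟨h, hq⟩
    obtain ⟨s, hs⟩ := (Projectivization.mk_eq_mk_iff' ℂ _ _ _ _).1 hq
    rw [he] at hs h
    refine ⟨(8 * Complex.I)⁻¹ * s, mul_ne_zero (inv_ne_zero h8) ?_, ?_⟩
    · rintro rfl
      exact h (by rw [← hs, zero_smul])
    · rw [mul_smul, hs, inv_smul_smul₀ h8]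
  · rintro ⟨s, hs, h⟩
    rw [h, smul_smul] at he
    refine ⟨he ▸ smul_ne_zero (mul_ne_zero h8 hs) hy, ?_⟩
    rw [Projectivization.mk_eq_mk_iff']
    exact ⟨_, he.symm⟩

/-- The fibre over a general point of the cubic threefold: sixteen points `t`, each of which
contributes sixteen points of `ℙ³`. -/
lemma encard_fiber {y : Fin 5 → ℂ} (hy0 : y ≠ 0) (hy : MvPolynomial.eval y hudsonCubic = 0)
    (hP : MvPolynomial.eval y genericityPolynomial ≠ 0) :
    {q | RatMapsTo kummerCoefficients q (Projectivization.mk ℂ y hy0)}.encard = 256 := by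
  obtain ⟨hs, ht⟩ := (eval_genericityPolynomial_ne_zero_iff y).1 hP
  have hcard := card_roots_fiberPolynomial hP
  have hroot (t : ℂ) : t ∈ (fiberPolynomial y).roots.toFinset ↔
      igusaQuartic (kleinCoefficients (cubicSection y) t) = 0 := by
    have hf : fiberPolynomial y ≠ 0 := by
      intro h
      simp [h] at hcard
    rw [Multiset.mem_toFinset, Polynomial.mem_roots hf, Polynomial.IsRoot.def,
      eval_fiberPolynomial]
  have hx0 : cubicSection y 0 ≠ 0 := by
    intro h
    apply hs
    rw [sectionFactor]
    change 2 * y 4 * sectionN y = 0 at h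
    linear_combination (-2 * sectionM y) * h
  set S := (fiberPolynomial y).roots.toFinset with hS
  have hS' (t : S) := ht t.1 (by rw [eval_fiberPolynomial]; exact (hroot t).1 t.2)
  have hG (t : S) : kleinCoefficients (cubicSection y) t.1 0 ≠ 0 := by
    have hu := (hS' t).2.2
    rw [show kleinCoefficients (cubicSection y) t.1 0 = -2 * cubicSection y 0 *
      (branchDifferences (cubicSection y) t.1 2 * branchDifferences (cubicSection y) t.1 3 *
        branchDifferences (cubicSection y) t.1 4) by
      simp [kleinCoefficients, cofactorCoefficients, branchDifferences]
      ring]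
    exact mul_ne_zero (mul_ne_zero (by norm_num) hx0) (mul_ne_zero (mul_ne_zero (hu 2) (hu 3)) (hu 4))
  choose f hf hfr using fun t : S => exists_sixteen_points ((hroot t).1 t.2) (hG t) (hS' t).2.1
  have hinj : Function.Injective fun z : S × ((ℤˣ × ℤˣ) × (ℤˣ × ℤˣ)) => f z.1 z.2 := by
    rintro ⟨t, ε⟩ ⟨t', ε'⟩ h
    obtain ⟨σ, hσ, h1⟩ := (hfr t (f t ε)).1 ⟨ε, rfl⟩
    obtain ⟨σ', hσ', h2⟩ := (hfr t' (f t' ε')).1 ⟨ε', rfl⟩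
    obtain rfl : t = t' := by
      refine Subtype.ext (eq_of_kleinCoefficients_eq_smul hx0 (mul_ne_zero (inv_ne_zero hσ') hσ)
        (hS' t).2.2 ?_)
      dsimp only at h
      rw [mul_smul, ← h1, h, h2, inv_smul_smul₀ hσ']
    exact Prod.ext rfl (hf t h)
  have hrange : {q | RatMapsTo kummerCoefficients q (Projectivization.mk ℂ y hy0)} =
      Set.range fun z : S × ((ℤˣ × ℤˣ) × (ℤˣ × ℤˣ)) => f z.1 z.2 := by
    ext q
    rw [Set.mem_ofPred_eq, ratMapsTo_kummerCoefficients_iff]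
    constructor
    · rintro ⟨s, hs0, h⟩
      obtain ⟨t, σ, hσ, hp⟩ := exists_eq_smul_kleinCoefficients hs0 h hs
      have htS : t ∈ S := by
        have h0 := igusaQuartic_heisenbergQuartics q.rep
        rw [hp, igusaQuartic_smul] at h0
        exact (hroot t).2 ((mul_eq_zero.1 h0).resolve_left (pow_ne_zero 4 hσ))
      obtain ⟨ε, hε⟩ := (hfr ⟨t, htS⟩ q).2 ⟨σ, hσ, hp⟩
      exact ⟨(⟨t, htS⟩, ε), hε⟩
    · rintro ⟨⟨t, ε⟩, rfl⟩
      obtain ⟨σ, hσ, h⟩ := (hfr t (f t ε)).1 ⟨ε, rfl⟩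
      refine ⟨σ ^ 3 * (-4 * (∏ i, branchDifferences (cubicSection y) t i) ^ 2 * sectionFactor y),
        mul_ne_zero (pow_ne_zero 3 hσ) (mul_ne_zero (mul_ne_zero (by norm_num) (pow_ne_zero 2
          (Finset.prod_ne_zero_iff.2 fun i _ => (hS' t).2.2 i))) hs), ?_⟩
      dsimp only
      rw [h, hudsonCoefficients_smul, hudsonCoefficients_kleinCoefficients,
        cubicParametrization_cubicSection hy, smul_smul, smul_smul, mul_assoc]
  rw [hrange, ← Set.image_univ, hinj.encard_image, Set.encard_univ,
    ENat.card_eq_coe_fintype_card, Fintype.card_prod, Fintype.card_coe, hcard]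
  rfl

/-- If a polynomial does not vanish at a point, then one of its homogeneous parts does not vanish
there either; and where that part does not vanish, the polynomial does not vanish on the whole
line through the origin. -/
lemma exists_homogeneous_part {n : ℕ} {P : MvPolynomial (Fin n) ℂ} {y₀ : Fin n → ℂ}
    (h : MvPolynomial.eval y₀ P ≠ 0) : ∃ (Q : MvPolynomial (Fin n) ℂ) (d : ℕ), Q.IsHomogeneous d ∧
      MvPolynomial.eval y₀ Q ≠ 0 ∧
      ∀ y, MvPolynomial.eval y Q ≠ 0 → ∃ c : ℂ, c ≠ 0 ∧ MvPolynomial.eval (c • y) P ≠ 0 := by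
  obtain ⟨d, hd⟩ : ∃ d, MvPolynomial.eval y₀ (MvPolynomial.homogeneousComponent d P) ≠ 0 := by
    by_contra! hd
    apply h
    rw [← MvPolynomial.sum_homogeneousComponent P, map_sum]
    exact Finset.sum_eq_zero fun i _ => hd i
  refine ⟨_, d, MvPolynomial.homogeneousComponent_isHomogeneous d P, hd, fun y hy => ?_⟩
  set N := P.totalDegree + 1
  set f : Polynomial ℂ := ∑ i ∈ Finset.range N,
    Polynomial.C (MvPolynomial.eval y (MvPolynomial.homogeneousComponent i P)) * Polynomial.X ^ i
    with hf
  have hfe (c : ℂ) : f.eval c = MvPolynomial.eval (c • y) P := by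
    conv_rhs => rw [← MvPolynomial.sum_homogeneousComponent P, map_sum]
    rw [hf, Polynomial.eval_finsetSum]
    refine Finset.sum_congr rfl fun i _ => ?_
    rw [eval_smul_of_isHomogeneous (MvPolynomial.homogeneousComponent_isHomogeneous i P)]
    rw [Polynomial.eval_mul, Polynomial.eval_C, Polynomial.eval_pow, Polynomial.eval_X, mul_comm]
  have hdN : d < N := by
    by_contra! hlt
    exact hy (by rw [MvPolynomial.homogeneousComponent_eq_zero _ _ (by omega), map_zero])
  have hfd : f.coeff d ≠ 0 := by
    simpa [hf, Polynomial.finsetSum_coeff, Polynomial.coeff_X_pow, hdN] using hy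
  have hf0 : f * Polynomial.X ≠ 0 :=
    mul_ne_zero (fun h => hfd (by rw [h, Polynomial.coeff_zero])) Polynomial.X_ne_zero
  obtain ⟨c, hc⟩ : ∃ c, (f * Polynomial.X).eval c ≠ 0 := by
    by_contra! hc
    exact hf0 (Polynomial.funext fun c => by rw [hc c, Polynomial.eval_zero])
  rw [Polynomial.eval_mul, Polynomial.eval_X, mul_ne_zero_iff, hfe] at hc
  exact ⟨c, hc.2, hc.1⟩

/-! ### A point at which the genericity polynomial does not vanish -/

/-- For the parameters `(g, h, c, s) = (1, 2, 0, 0)` the polynomial of degree sixteen is, up to the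
factor `5`, the following polynomial in `τ = t²`. -/
noncomputable def sampleOctic : Polynomial ℂ :=
  Polynomial.X ^ 8 - 20 * Polynomial.X ^ 7 + 238 * Polynomial.X ^ 6 - 308 * Polynomial.X ^ 5 -
    167 * Polynomial.X ^ 4 - 1232 * Polynomial.X ^ 3 + 3808 * Polynomial.X ^ 2 -
    1280 * Polynomial.X + 256

lemma eval_sampleOctic (τ : ℂ) : sampleOctic.eval τ = τ ^ 8 - 20 * τ ^ 7 + 238 * τ ^ 6 -
    308 * τ ^ 5 - 167 * τ ^ 4 - 1232 * τ ^ 3 + 3808 * τ ^ 2 - 1280 * τ + 256 := by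
  simp [sampleOctic]

lemma eval_derivative_sampleOctic (τ : ℂ) : (Polynomial.derivative sampleOctic).eval τ =
    8 * τ ^ 7 - 140 * τ ^ 6 + 1428 * τ ^ 5 - 1540 * τ ^ 4 - 668 * τ ^ 3 - 3696 * τ ^ 2 +
      7616 * τ - 1280 := by
  simp [sampleOctic]
  ring

lemma igusaQuartic_sample (t : ℂ) :
    igusaQuartic (kleinCoefficients ![1, 2, 0, 0] t) = 5 * sampleOctic.eval (t ^ 2) := by
  rw [eval_sampleOctic]
  simp [igusaQuartic, kleinCoefficients, cofactorCoefficients, branchDifferences]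
  ring

lemma fiberPolynomial_sample {y : Fin 5 → ℂ} (hy : cubicSection y = ![1, 2, 0, 0]) :
    fiberPolynomial y = 5 * sampleOctic.comp (Polynomial.X ^ 2) := by
  refine Polynomial.funext fun t => ?_
  rw [eval_fiberPolynomial, hy, igusaQuartic_sample]
  simp

/-- Since `τ⁸ F(4/τ)` is proportional to `F`, the octic is a quartic in `w = τ + 4/τ`. -/
lemma eval_sampleOctic_eq {τ w : ℂ} (hw : τ * w = τ ^ 2 + 4) : sampleOctic.eval τ =
    τ ^ 4 * (w ^ 4 - 20 * w ^ 3 + 222 * w ^ 2 - 68 * w - 2039) := by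
  rw [eval_sampleOctic, show τ ^ 4 * (w ^ 4 - 20 * w ^ 3 + 222 * w ^ 2 - 68 * w - 2039) =
    (τ * w) ^ 4 - 20 * τ * (τ * w) ^ 3 + 222 * τ ^ 2 * (τ * w) ^ 2 - 68 * τ ^ 3 * (τ * w) -
      2039 * τ ^ 4 by ring, hw]
  ring

lemma eval_derivative_sampleOctic_ne_zero {τ : ℂ} (h : sampleOctic.eval τ = 0) :
    (Polynomial.derivative sampleOctic).eval τ ≠ 0 := by
  intro h'
  have hτ : τ ≠ 0 := by
    rintro rfl
    rw [eval_sampleOctic] at h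
    norm_num at h
  obtain ⟨w, hw⟩ : ∃ w, τ * w = τ ^ 2 + 4 := ⟨(τ ^ 2 + 4) / τ, mul_div_cancel₀ _ hτ⟩
  have hq := h
  rw [eval_sampleOctic_eq hw] at hq
  replace hq := (mul_eq_zero.1 hq).resolve_left (pow_ne_zero 4 hτ)
  have hd : τ ^ 2 * ((τ ^ 2 - 4) * (4 * w ^ 3 - 60 * w ^ 2 + 444 * w - 68)) = 0 := by
    rw [eval_derivative_sampleOctic] at h'
    have : τ ^ 3 * (4 * w ^ 3 - 60 * w ^ 2 + 444 * w - 68) = 4 * (τ * w) ^ 3 - 60 * τ * (τ * w) ^ 2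
      + 444 * τ ^ 2 * (τ * w) - 68 * τ ^ 3 := by ring
    rw [hw] at this
    rw [eval_sampleOctic] at h
    refine mul_left_cancel₀ hτ ?_
    linear_combination τ * h' - 4 * h + (τ ^ 2 - 4) * this
  rcases mul_eq_zero.1 ((mul_eq_zero.1 hd).resolve_left (pow_ne_zero 2 hτ)) with h4 | h4
  · have h4' : (τ - 2) * (τ + 2) = 0 := by linear_combination h4
    rw [eval_sampleOctic] at h
    rcases mul_eq_zero.1 h4' with h5 | h5
    · rw [sub_eq_zero.1 h5] at h
      norm_num at h
    · rw [eq_neg_of_add_eq_zero_left h5] at h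
      norm_num at h
  · -- The quartic in `w` and its derivative are coprime.
    have : (663552 : ℂ) = 0 := by
      linear_combination -(4 * w ^ 2 - 48 * w + 332) * hq
        + (w ^ 3 - 17 * w ^ 2 + 179 * w + 197) * h4
    norm_num at this

lemma squareTargets_sample_ne_zero {t : ℂ} (h : sampleOctic.eval (t ^ 2) = 0) (i : Fin 4) :
    squareTargets (kleinCoefficients ![1, 2, 0, 0] t) i ≠ 0 := by
  intro h'
  obtain ⟨τ, hτ⟩ : ∃ τ, t ^ 2 = τ := ⟨_, rfl⟩
  have h3 : (τ ^ 4 - 22 * τ ^ 3 + 33 * τ ^ 2 + 8 * τ + 16) *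
      ((τ ^ 2 + τ + 4) * (τ ^ 2 - 11 * τ + 4)) = 0 := by
    have e : ∏ i, squareTargets (kleinCoefficients ![1, 2, 0, 0] t) i = 0 :=
      Finset.prod_eq_zero (Finset.mem_univ i) h'
    simp only [Fin.prod_univ_four, squareTargets, kleinCoefficients, cofactorCoefficients,
      branchDifferences, Matrix.cons_val_zero, Matrix.cons_val_one, Matrix.cons_val] at e
    rw [← hτ]
    linear_combination -e
  rw [hτ] at h
  have hτ0 : τ ≠ 0 := by
    rintro rfl
    rw [eval_sampleOctic] at h
    norm_num at h
  rcases mul_eq_zero.1 h3 with h4 | h4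
  · rw [eval_sampleOctic] at h
    -- The octic is coprime to the quartic `h4`.
    have : (5308416 : ℂ) = 0 := by
      linear_combination (61 * τ ^ 3 - 1432 * τ ^ 2 + 3929 * τ - 1170) * h +
        (-61 * τ ^ 7 + 1310 * τ ^ 6 - 16254 * τ ^ 5 + 39024 * τ ^ 4 - 3965 * τ ^ 3 + 58650 * τ ^ 2
          - 331712 * τ + 350496) * h4
    norm_num at this
  · rcases mul_eq_zero.1 h4 with h5 | h5
    · rw [eval_sampleOctic_eq (w := -1) (by linear_combination -h5)] at h
      norm_num [hτ0] at h
    · rw [eval_sampleOctic_eq (w := 11) (by linear_combination -h5)] at h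
      norm_num [hτ0] at h

lemma branchDifferences_sample_ne_zero {t : ℂ} (h : sampleOctic.eval (t ^ 2) = 0) (i : Fin 5) :
    branchDifferences ![1, 2, 0, 0] t i ≠ 0 := by
  intro h'
  have ht : t = 0 ∨ t ^ 2 = 1 ∨ t ^ 2 = 4 := by
    fin_cases i <;> simp [branchDifferences] at h'
    · exact Or.inr (Or.inl (by linear_combination (-t + 1) * h'))
    · exact Or.inr (Or.inl (by linear_combination (-t - 1) * h'))
    · exact Or.inr (Or.inr (by linear_combination (-t + 2) * h'))
    · exact Or.inr (Or.inr (by linear_combination (-t - 2) * h'))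
    · exact Or.inl h'
  rw [eval_sampleOctic] at h
  rcases ht with ht | ht | ht <;> rw [ht] at h <;> norm_num at h

lemma exists_sample_point : ∃ y : Fin 5 → ℂ, y ≠ 0 ∧ MvPolynomial.eval y hudsonCubic = 0 ∧
    MvPolynomial.eval y genericityPolynomial ≠ 0 := by
  -- The point is `cubicParametrization ![1, 2, 0, 0]`, rescaled so that its section is exactly
  -- `![1, 2, 0, 0]`.
  obtain ⟨z, hz⟩ := IsAlgClosed.exists_pow_nat_eq (-1 / 32 : ℂ) (n := 3) (by norm_num)
  have hx : cubicSection (![0, 0, 5, 3, -2] : Fin 5 → ℂ) = (-32 : ℂ) • ![1, 2, 0, 0] := by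
    ext i
    fin_cases i <;> simp [cubicSection, sectionM, sectionN] <;> norm_num
  have hs : sectionFactor (![0, 0, 5, 3, -2] : Fin 5 → ℂ) ≠ 0 := by
    simp [sectionFactor, sectionM, sectionN]
    norm_num
  have hz0 : z ≠ 0 := by
    rintro rfl
    norm_num at hz
  set y : Fin 5 → ℂ := z • ![0, 0, 5, 3, -2] with hy
  have hsy : sectionFactor y ≠ 0 := by
    rw [hy, sectionFactor_smul]
    exact mul_ne_zero (pow_ne_zero _ hz0) hs
  have hxy : cubicSection y = ![1, 2, 0, 0] := by
    rw [hy, cubicSection_smul, hz, hx, smul_smul]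
    norm_num
  refine ⟨y, ?_, ?_, ?_⟩
  · intro h
    simp [h, sectionFactor] at hsy
  · rw [hy, eval_smul_of_isHomogeneous hudsonCubic_isHomogeneous, eval_hudsonCubic]
    simp
    norm_num
  · refine (eval_genericityPolynomial_ne_zero_iff y).2 ⟨hsy, fun t ht => ?_⟩
    have hF : sampleOctic.eval (t ^ 2) = 0 := by
      rw [eval_fiberPolynomial, hxy, igusaQuartic_sample] at ht
      exact (mul_eq_zero.1 ht).resolve_left (by norm_num)
    rw [hxy]
    refine ⟨?_, squareTargets_sample_ne_zero hF, branchDifferences_sample_ne_zero hF⟩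
    have ht0 : t ≠ 0 := by
      rintro rfl
      rw [eval_sampleOctic] at hF
      norm_num at hF
    rw [fiberPolynomial_sample hxy]
    have hd := eval_derivative_sampleOctic_ne_zero hF
    simp [Polynomial.derivative_comp, hd, ht0]

/-! ### The image of the rational map -/

lemma ratMapsTo_mem_hudsonCubic {q : ℙ ℂ (Fin 4 → ℂ)} {y : ℙ ℂ (Fin 5 → ℂ)}
    (h : RatMapsTo kummerCoefficients q y) : y ∈ zeroLocus {hudsonCubic} := by
  induction y using Projectivization.ind with
  | h y hy =>
    obtain ⟨s, hs, h⟩ := (ratMapsTo_kummerCoefficients_iff hy).1 h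
    refine (mk_mem_zeroLocus ?_ hy).2 ?_
    · rintro F rfl
      exact ⟨3, hudsonCubic_isHomogeneous⟩
    · rintro F rfl
      have h0 := eval_hudsonCubic_hudsonCoefficients (heisenbergQuartics Complex.I q.rep)
      rw [h, eval_smul_of_isHomogeneous hudsonCubic_isHomogeneous] at h0
      exact (mul_eq_zero.1 h0).resolve_left (pow_ne_zero 3 hs)

/-- The rational map has fibres with `256` points over the complement of a hypersurface which does
not contain the cubic threefold. -/
lemma exists_hypersurface : ∃ (Q : MvPolynomial (Fin 5) ℂ) (d : ℕ) (y₀ : Fin 5 → ℂ),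
    Q.IsHomogeneous d ∧ y₀ ≠ 0 ∧ MvPolynomial.eval y₀ hudsonCubic = 0 ∧
    MvPolynomial.eval y₀ Q ≠ 0 ∧
    ∀ y (hy : y ≠ 0), MvPolynomial.eval y hudsonCubic = 0 → MvPolynomial.eval y Q ≠ 0 →
      {q | RatMapsTo kummerCoefficients q (Projectivization.mk ℂ y hy)}.encard = 256 := by
  obtain ⟨y₀, hne, hy₀, hP⟩ := exists_sample_point
  obtain ⟨Q, d, hQ, hQ₀, h⟩ := exists_homogeneous_part hP
  refine ⟨Q, d, y₀, hQ, hne, hy₀, hQ₀, fun y hy hyH hyQ => ?_⟩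
  obtain ⟨c, hc, hcP⟩ := h y hyQ
  have hcy : c • y ≠ 0 := smul_ne_zero hc hy
  have hmk : Projectivization.mk ℂ y hy = Projectivization.mk ℂ (c • y) hcy :=
    ((Projectivization.mk_eq_mk_iff' ℂ _ _ _ _).2 ⟨c, rfl⟩).symm
  rw [hmk]
  refine encard_fiber hcy ?_ hcP
  rw [eval_smul_of_isHomogeneous hudsonCubic_isHomogeneous, hyH, mul_zero]

lemma ratImage_kummerCoefficients : ratImage kummerCoefficients = zeroLocus {hudsonCubic} := by
  obtain ⟨Q, d, y₀, -, hne, hy₀, hQ₀, h⟩ := exists_hypersurface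
  refine zariskiClosure_eq_hudsonCubic ?_ hne hy₀ hQ₀ fun y hy hyH hyQ => ?_
  · rintro y ⟨q, hq⟩
    exact ratMapsTo_mem_hudsonCubic hq
  · obtain ⟨q, hq⟩ : {q | RatMapsTo kummerCoefficients q (Projectivization.mk ℂ y hy)}.Nonempty := by
      rw [← Set.encard_ne_zero, h y hy hyH hyQ]
      norm_num
    exact ⟨q, hq⟩

lemma isGenericallyFiniteOfDegree_kummerCoefficients :
    IsGenericallyFiniteOfDegree kummerCoefficients 256 := by
  obtain ⟨Q, d, y₀, hQ, hne, hy₀, hQ₀, h⟩ := exists_hypersurface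
  have hQS : ∀ F ∈ ({Q} : Set (MvPolynomial (Fin 5) ℂ)), ∃ d, F.IsHomogeneous d := by
    rintro F rfl
    exact ⟨d, hQ⟩
  have hHS : ∀ F ∈ ({hudsonCubic} : Set (MvPolynomial (Fin 5) ℂ)), ∃ d, F.IsHomogeneous d := by
    rintro F rfl
    exact ⟨3, hudsonCubic_isHomogeneous⟩
  refine ⟨zeroLocus {Q}, zariskiClosure_zeroLocus hQS, ?_, ?_⟩
  · rw [ratImage_kummerCoefficients]
    refine zariskiClosure_eq_hudsonCubic Set.sdiff_subset hne hy₀ hQ₀ fun y hy hyH hyQ => ⟨?_, ?_⟩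
    · exact (mk_mem_zeroLocus hHS hy).2 (by rintro F rfl; exact hyH)
    · exact fun hmem => hyQ ((mk_mem_zeroLocus hQS hy).1 hmem Q rfl)
  · rw [ratImage_kummerCoefficients]
    rintro y ⟨hyH, hyQ⟩
    induction y using Projectivization.ind with
    | h y hy =>
      refine h y hy ((mk_mem_zeroLocus hHS hy).1 hyH _ rfl) fun h0 => hyQ ?_
      exact (mk_mem_zeroLocus hQS hy).2 (by rintro F rfl; exact h0)

end SpinorKummer

theorem mainTheorem3 :
    ∃ κ : Fin 5 → MvPolynomial (Fin 4) ℂ,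
      (∀ i, (κ i).IsHomogeneous 12) ∧
      LinearIndependent ℂ κ ∧
      (∀ a : Fin 4 → ℂ, SpinorKummer.IsKummerEquation a fun h =>
        SpinorKummer.hudsonQuartic (fun i => MvPolynomial.eval a (κ i))
          (h 0) (h 1) (SpinorKummer.zeta8 * h 2) (SpinorKummer.zeta8 * h 3)) ∧
      SpinorKummer.IsGenericallyFiniteOfDegree κ 256 ∧
      SpinorKummer.ratImage κ = SpinorKummer.zeroLocus {SpinorKummer.hudsonCubic} ∧
      SpinorKummer.ProjectivelyIsomorphic (SpinorKummer.ratImage κ) SpinorKummer.segreCubic ∧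
      SpinorKummer.ProjectivelyIsomorphic (SpinorKummer.ratImage κ)
        (SpinorKummer.dualHypersurface SpinorKummer.castelnuovoRichmond) := by
  exact ⟨SpinorKummer.kummerCoefficients, SpinorKummer.kummerCoefficients_isHomogeneous,
    SpinorKummer.linearIndependent_kummerCoefficients, SpinorKummer.isKummerEquation,
    SpinorKummer.isGenericallyFiniteOfDegree_kummerCoefficients,
    SpinorKummer.ratImage_kummerCoefficients,
    SpinorKummer.ratImage_kummerCoefficients ▸
      SpinorKummer.hudsonCubic_projectivelyIsomorphic_segreCubic,
    SpinorKummer.ratImage_kummerCoefficients ▸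
      SpinorKummer.hudsonCubic_projectivelyIsomorphic_dualHypersurface⟩
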